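/- Let $k$ be a field and let $A$ be a connected cochain DG algebra over $k$: a graded $k$-algebra $A=\bigoplus_{i\ge 0}A^i$ with $A^0=k$, with a $k$-linear differential $\partial$ of degree $1$ such that $\partial^2=0$ and $\partial(ab)=\partial(a)b+(-1)^{|a|}a\,\partial(b)$. Let $D(A)$ be the derived category of (left) DG $A$-modules, with suspension $\Sigma$, and let $D^c(A)$ be the full subcategory of compact objects, i.e. of those $M$ for which $\mathrm{Hom}_{D(A)}(M,-)$ preserves all coproducts. A morphism $f$ of $D(A)$ is a ghost if $H(f)=0$. The ghost length $\mathrm{gh.len}_A M$ is $-1$ if $M$ is a zero object of $D(A)$; otherwise it is the number $n\ge 0$ such that every composite $M\to I_1\to\cdots\to I_{n+1}$ of $n+1$ ghosts is zero and some composite of $n$ ghosts starting at $M$ is non-zero (the empty composite being $\mathrm{id}_M$), and $+\infty$ if there is no such $n$. The left ghost dimension of $A$ is $l.\mathrm{gh.dim}\,A=\sup\{\mathrm{gh.len}_A M \mid M\in D^c(A)\}$. Let $\langle A\rangle_0$ be the class of zero objects of $D(A)$; let $\langle A\rangle_1$ be the closure under isomorphisms and direct summands of the class of finite direct sums of suspensions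 $\Sigma^iA$, $i\in\mathbb Z$; and for $n\ge 2$ let $\langle A\rangle_n$ be the closure under isomorphisms and direct summands of the class of all $M$ for which there is an exact triangle $L\to M\to N\to\Sigma L$ with $L\in\langle A\rangle_{n-1}$ and $N\in\langle A\rangle_1$. The level of $M$ is $\mathrm{level}^A_{D(A)}(M)=\inf\{n\ge 0\mid M\in\langle A\rangle_n\}$, and the Rouquier dimension is $\mathrm{Rouq.dim}\,A=\inf\{n\ge 0\mid \langle A\rangle_n=D^c(A)\}$, with $\inf\emptyset=+\infty$ in both cases. Then for every $M\in D^c(A)$ $$\mathrm{gh.len}_A M=\mathrm{level}^A_{D(A)}(M)-1,$$ and $$\mathrm{Rouq.dim}\,A=l.\mathrm{gh.dim}\,A+1,$$ as equalities in $\mathbb Z\cup\{+\infty\}$. -/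

import Mathlib

open CategoryTheory CategoryTheory.Limits

universe u

noncomputable section

/-! ### DG algebras -/

/-- A (cohomologically graded) DG algebra over `k`: a `ℤ`-graded `k`-algebra with a `k`-linear
differential of degree `1` that squares to zero and satisfies the graded Leibniz rule. -/
structure DGAlg (k : Type u) [Field k] where
  carrier : Type u
  [ring : Ring carrier]
  [algebra : Algebra k carrier]
  gr : ℤ → Submodule k carrier
  [graded : GradedAlgebra gr]
  d : carrier →ₗ[k] carrier
  d_mem : ∀ {p : ℤ} {a : carrier}, a ∈ gr p → d a ∈ gr (p + 1)
  d_d : ∀ a : carrier, d (d a) = 0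
  leibniz : ∀ {p : ℤ} {a : carrier} (b : carrier), a ∈ gr p →
    d (a * b) = d a * b + p.negOnePow • (a * d b)

namespace DGAlg

attribute [instance] DGAlg.ring DGAlg.algebra DGAlg.graded

variable {k : Type u} [Field k]

/-- A connected cochain DG algebra: it is concentrated in non-negative degrees, and its component
of degree `0` is `k` (through the structure map, which is injective). -/
structure IsConnectedCochain (A : DGAlg k) : Prop where
  gr_neg : ∀ p : ℤ, p < 0 → A.gr p = ⊥
  injective : Function.Injective (algebraMap k A.carrier)
  gr_zero : A.gr 0 = LinearMap.range (Algebra.linearMap k A.carrier)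

variable (A : DGAlg k)

/-- The unit, as an element of degree `0`. -/
def oneGr : A.gr 0 := ⟨1, SetLike.one_mem_graded A.gr⟩

/-- The product of homogeneous elements. -/
def mulGr {p p' s : ℤ} (h : p + p' = s) (a : A.gr p) (b : A.gr p') : A.gr s :=
  ⟨a.1 * b.1, h ▸ SetLike.mul_mem_graded a.2 b.2⟩

/-- The differential of a homogeneous element. -/
def dGr {p p' : ℤ} (h : p + 1 = p') (a : A.gr p) : A.gr p' :=
  ⟨A.d a.1, h ▸ A.d_mem a.2⟩

end DGAlg

variable {k : Type u} [Field k]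

/-! ### DG modules -/

/-- A left DG module over `A`, given by its homogeneous components. Degrees that have to add up
do so through an explicit equation. The `k`-vector space structure is the one obtained by
restricting the action along `k → A`; as `d 1 = 0` in `A`, the differential is `k`-linear by the
Leibniz rule. -/
structure DGMod (A : DGAlg k) where
  X : ℤ → Type u
  [grp : ∀ q, AddCommGroup (X q)]
  d : ∀ {q q' : ℤ}, q + 1 = q' → (X q →+ X q')
  d_d : ∀ {q q' q'' : ℤ} (h : q + 1 = q') (h' : q' + 1 = q'') (x : X q), d h' (d h x) = 0
  smul : ∀ {p q n : ℤ}, p + q = n → (A.gr p →+ X q →+ X n)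
  one_smul : ∀ {q : ℤ} (h : 0 + q = q) (x : X q), smul h A.oneGr x = x
  mul_smul : ∀ {p p' s q r n : ℤ} (hs : p + p' = s) (hsn : s + q = n) (hr : p' + q = r)
    (hn : p + r = n) (a : A.gr p) (b : A.gr p') (x : X q),
    smul hsn (A.mulGr hs a b) x = smul hn a (smul hr b x)
  leibniz : ∀ {p p' q q' n n' : ℤ} (hp : p + 1 = p') (hq : q + 1 = q') (hn : n + 1 = n')
    (h : p + q = n) (h₁ : p' + q = n') (h₂ : p + q' = n') (a : A.gr p) (x : X q),
    d hn (smul h a x) = smul h₁ (A.dGr hp a) x + p.negOnePow • smul h₂ a (d hq x)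

namespace DGMod

attribute [instance] DGMod.grp

variable {A : DGAlg k}

/-- DG morphisms: `A`-linear maps of degree `0` that commute with the differentials. -/
@[ext]
structure Hom (M N : DGMod A) where
  f : ∀ q : ℤ, M.X q →+ N.X q
  comm : ∀ {q q' : ℤ} (h : q + 1 = q') (x : M.X q), f q' (M.d h x) = N.d h (f q x)
  map_smul : ∀ {p q n : ℤ} (h : p + q = n) (a : A.gr p) (x : M.X q),
    f n (M.smul h a x) = N.smul h a (f q x)

/-- The category of DG modules over `A`. -/
instance : Category (DGMod A) where
  Hom M N := Hom M N
  id M := ⟨fun _ => AddMonoidHom.id _, fun _ _ => rfl, fun _ _ _ => rfl⟩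
  comp φ ψ := ⟨fun q => (ψ.f q).comp (φ.f q), fun h x => by simp [φ.comm, ψ.comm],
    fun h a x => by simp [φ.map_smul, ψ.map_smul]⟩

@[ext]
lemma hom_ext {M N : DGMod A} {φ ψ : M ⟶ N} (h : ∀ q x, Hom.f φ q x = Hom.f ψ q x) : φ = ψ :=
  Hom.ext (funext fun q => AddMonoidHom.ext (h q))

@[simp] lemma id_f (M : DGMod A) (q : ℤ) (x : M.X q) : Hom.f (𝟙 M) q x = x := rfl
@[simp] lemma comp_f {M N P : DGMod A} (φ : M ⟶ N) (ψ : N ⟶ P) (q : ℤ) (x : M.X q) :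
    Hom.f (φ ≫ ψ) q x = Hom.f ψ q (Hom.f φ q x) := rfl

lemma map_units_smul {G H : Type*} [AddCommGroup G] [AddCommGroup H] (f : G →+ H) (e : ℤˣ)
    (x : G) : f (e • x) = e • f x := by
  simp [Units.smul_def]

instance (M N : DGMod A) : Zero (M ⟶ N) := ⟨⟨fun _ => 0, by simp, by simp⟩⟩
instance (M N : DGMod A) : Add (M ⟶ N) :=
  ⟨fun φ ψ => ⟨fun q => Hom.f φ q + Hom.f ψ q,
    fun h x => by simp [Hom.comm φ h, Hom.comm ψ h],
    fun h a x => by simp [Hom.map_smul φ h, Hom.map_smul ψ h]⟩⟩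
instance (M N : DGMod A) : Neg (M ⟶ N) :=
  ⟨fun φ => ⟨fun q => -Hom.f φ q,
    fun h x => by simp [Hom.comm φ h],
    fun h a x => by simp [Hom.map_smul φ h]⟩⟩

@[simp] lemma zero_f (M N : DGMod A) (q : ℤ) (x : M.X q) : Hom.f (0 : M ⟶ N) q x = 0 := rfl
@[simp] lemma add_f {M N : DGMod A} (φ ψ : M ⟶ N) (q : ℤ) (x : M.X q) :
    Hom.f (φ + ψ) q x = Hom.f φ q x + Hom.f ψ q x := rfl
@[simp] lemma neg_f {M N : DGMod A} (φ : M ⟶ N) (q : ℤ) (x : M.X q) :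
    Hom.f (-φ) q x = -Hom.f φ q x := rfl

instance (M N : DGMod A) : AddCommGroup (M ⟶ N) where
  add_assoc _ _ _ := by ext; simp [add_assoc]
  zero_add _ := by ext; simp
  add_zero _ := by ext; simp
  add_comm _ _ := by ext; simp [add_comm]
  neg_add_cancel _ := by ext; simp
  nsmul := nsmulRec
  zsmul := zsmulRec

instance : Preadditive (DGMod A) where
  add_comp _ _ _ _ _ _ := by ext; simp
  comp_add _ _ _ _ _ _ := by ext; simp

/-- The DG module `A`. -/
def self (A : DGAlg k) : DGMod A where
  X q := A.gr q
  d h := { toFun := A.dGr h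
           map_zero' := by ext; simp [DGAlg.dGr]
           map_add' := fun _ _ => by ext; simp [DGAlg.dGr] }
  d_d h h' x := by ext; simp [DGAlg.dGr, A.d_d]
  smul h := AddMonoidHom.mk' (fun a => AddMonoidHom.mk' (fun b => A.mulGr h a b)
      (fun _ _ => by ext; simp [DGAlg.mulGr, mul_add]))
    (fun _ _ => by ext; simp [DGAlg.mulGr, add_mul])
  one_smul h x := by ext; simp [DGAlg.mulGr, DGAlg.oneGr]
  mul_smul hs hsn hr hn a b x := by ext; simp [DGAlg.mulGr, mul_assoc]
  leibniz hp hq hn h h₁ h₂ a x := by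
    ext; simp [DGAlg.mulGr, DGAlg.dGr, A.leibniz _ a.2, Units.smul_def]

/-- Transport of an element along an equality of degrees. -/
def cast (M : DGMod A) {q q' : ℤ} (h : q = q') : M.X q →+ M.X q' :=
  h ▸ AddMonoidHom.id (M.X q)

@[simp] lemma cast_rfl (M : DGMod A) {q : ℤ} (x : M.X q) : M.cast rfl x = x := rfl

lemma cast_smul (M : DGMod A) {p q n n' : ℤ} (h : p + q = n) (e : n = n') (a : A.gr p)
    (x : M.X q) : M.cast e (M.smul h a x) = M.smul (h.trans e) a x := by
  subst e; rfl

lemma smul_cast (M : DGMod A) {p q q' n : ℤ} (e : q = q') (h : p + q' = n) (a : A.gr p)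
    (x : M.X q) : M.smul h a (M.cast e x) = M.smul (e.symm ▸ h) a x := by
  subst e; rfl

lemma cast_d (M : DGMod A) {q n n' : ℤ} (h : q + 1 = n) (e : n = n') (x : M.X q) :
    M.cast e (M.d h x) = M.d (h.trans e) x := by
  subst e; rfl

lemma d_cast (M : DGMod A) {q q' n : ℤ} (e : q = q') (h : q' + 1 = n) (x : M.X q) :
    M.d h (M.cast e x) = M.d (e.symm ▸ h) x := by
  subst e; rfl

lemma Hom.f_cast {M N : DGMod A} (φ : Hom M N) {q q' : ℤ} (e : q = q') (x : M.X q) :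
    φ.f q' (M.cast e x) = N.cast e (φ.f q x) := by
  subst e; rfl

/-- The suspension `Σ^i M`, with `(Σ^i M)^q = M^{q+i}`, action `a (Σ^i m) = (-1)^{|a| i} Σ^i (a m)`
and differential `d (Σ^i m) = (-1)^i Σ^i (d m)`. -/
def shift (i : ℤ) (M : DGMod A) : DGMod A where
  X q := M.X (q + i)
  d {q q'} h := i.negOnePow • M.d (show (q + i) + 1 = q' + i by lia)
  d_d h h' x := by simp [M.d_d]
  smul {p q n} h := (p * i).negOnePow • M.smul (show p + (q + i) = n + i by lia)
  one_smul {q} h x := by simpa using M.one_smul (zero_add _) x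
  mul_smul {p p' s q r n} hs hsn hr hn a b x := by
    subst hs
    simp [M.mul_smul rfl (show (p + p') + (q + i) = n + i by lia)
      (show p' + (q + i) = r + i by lia) (show p + (r + i) = n + i by lia), smul_smul, add_mul,
      Int.negOnePow_add]
    rw [mul_comm]
  leibniz {p p' q q' n n'} hp hq hn h h₁ h₂ a x := by
    subst hp
    simp [M.leibniz rfl (show (q + i) + 1 = q' + i by lia)
      (show (n + i) + 1 = n' + i by lia) (show p + (q + i) = n + i by lia)
      (show (p + 1) + (q + i) = n' + i by lia) (show p + (q' + i) = n' + i by lia), smul_smul,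
      add_mul, Int.negOnePow_add]
    rw [mul_comm i.negOnePow (p * i).negOnePow, mul_left_comm p.negOnePow, mul_comm p.negOnePow]

lemma shift_d (i : ℤ) (M : DGMod A) {q q' : ℤ} (h : q + 1 = q') (x : M.X (q + i)) :
    (M.shift i).d h x = i.negOnePow • M.d (show (q + i) + 1 = q' + i by lia) x := rfl

lemma shift_smul (i : ℤ) (M : DGMod A) {p q n : ℤ} (h : p + q = n) (a : A.gr p)
    (x : M.X (q + i)) : (M.shift i).smul h a x =
      (p * i).negOnePow • M.smul (show p + (q + i) = n + i by lia) a x := rfl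

/-- The suspension functor `Σ^i` on DG modules. -/
def shiftFun (A : DGAlg k) (i : ℤ) : DGMod A ⥤ DGMod A where
  obj M := M.shift i
  map {M N} φ :=
    { f := fun q => Hom.f φ (q + i)
      comm := fun {q q'} h x =>
        (map_units_smul (Hom.f φ (q' + i)) _ _).trans (congrArg (i.negOnePow • ·)
          (Hom.comm φ (show (q + i) + 1 = q' + i by lia) x))
      map_smul := fun {p q n} h a x =>
        (map_units_smul (Hom.f φ (n + i)) _ _).trans (congrArg ((p * i).negOnePow • ·)
          (Hom.map_smul φ (show p + (q + i) = n + i by lia) a x)) }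

/-- The mapping cone `Cone φ = N ⊕ Σ M` of `φ : M ⟶ N`, with differential
`d (n, Σ m) = (d n + φ m, - Σ (d m))` and action `a (n, Σ m) = (a n, (-1)^{|a|} Σ (a m))`. -/
def cone {M N : DGMod A} (φ : M ⟶ N) : DGMod A where
  X q := N.X q × M.X (q + 1)
  d {q q'} h := AddMonoidHom.mk'
    (fun z => (N.d h z.1 + Hom.f φ q' (M.cast h z.2),
      -M.d (show (q + 1) + 1 = q' + 1 by lia) z.2))
    (fun z w => by ext <;> simp <;> abel)
  d_d h h' z := by
    subst h h'
    ext <;> simp [N.d_d, M.d_d, Hom.comm φ rfl]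
  smul {p q n} h := AddMonoidHom.mk'
    (fun a => AddMonoidHom.mk'
      (fun z => (N.smul h a z.1,
        p.negOnePow • M.smul (show p + (q + 1) = n + 1 by lia) a z.2))
      (fun z w => by ext <;> simp))
    (fun a b => by ext <;> simp)
  one_smul {q} h z := by
    ext
    · simpa using N.one_smul h z.1
    · simpa using M.one_smul (zero_add _) z.2
  mul_smul {p p' s q r n} hs hsn hr hn a b z := by
    ext
    · simpa using N.mul_smul hs hsn hr hn a b z.1
    · subst hs
      simp [M.mul_smul rfl (show (p + p') + (q + 1) = n + 1 by lia)
        (show p' + (q + 1) = r + 1 by lia) (show p + (r + 1) = n + 1 by lia), smul_smul,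
        Int.negOnePow_add]
  leibniz {p p' q q' n n'} hp hq hn h h₁ h₂ a z := by
    subst hp
    ext
    · simp [N.leibniz rfl hq hn h h₁ h₂, cast_smul, smul_cast, Hom.f_cast,
        Hom.map_smul φ (show p + (q + 1) = n + 1 by lia)]
      abel
    · simp [M.leibniz rfl (show (q + 1) + 1 = q' + 1 by lia)
        (show (n + 1) + 1 = n' + 1 by lia) (show p + (q + 1) = n + 1 by lia)
        (show (p + 1) + (q + 1) = n' + 1 by lia) (show p + (q' + 1) = n' + 1 by lia), smul_smul,
        Int.negOnePow_add]
      abel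

/-- The inclusion `N ⟶ Cone φ`. -/
def coneInl {M N : DGMod A} (φ : M ⟶ N) : N ⟶ cone φ where
  f q := AddMonoidHom.inl _ _
  comm {q q'} h x := by
    change ((N.d h x, 0) : N.X q' × M.X (q' + 1)) = (N.d h x + Hom.f φ q' (M.cast h 0), -M.d _ 0)
    simp
  map_smul {p q n} h a x := by
    change ((N.smul h a x, 0) : N.X n × M.X (n + 1)) = (N.smul h a x, p.negOnePow • M.smul _ a 0)
    simp

/-- The projection `Cone φ ⟶ Σ M`. -/
def coneSnd {M N : DGMod A} (φ : M ⟶ N) : cone φ ⟶ (shiftFun A 1).obj M where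
  f q := AddMonoidHom.snd _ _
  comm {q q'} h x := by
    change -M.d (show (q + 1) + 1 = q' + 1 by lia) x.2 =
      (1 : ℤ).negOnePow • M.d (show (q + 1) + 1 = q' + 1 by lia) x.2
    simp
  map_smul {p q n} h a x := by
    change p.negOnePow • M.smul (show p + (q + 1) = n + 1 by lia) a x.2 =
      (p * 1).negOnePow • M.smul (show p + (q + 1) = n + 1 by lia) a x.2
    simp

/-! ### Finite direct sums of DG modules -/

/-- The zero DG module. -/
def zero (A : DGAlg k) : DGMod A where
  X _ := PUnit
  d _ := 0
  d_d _ _ _ := rfl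
  smul _ := 0
  one_smul _ _ := rfl
  mul_smul _ _ _ _ _ _ _ := rfl
  leibniz _ _ _ _ _ _ _ _ := rfl

lemma isZero_zero (A : DGAlg k) : IsZero (zero A) :=
  (IsZero.iff_id_eq_zero _).2 (by ext; rfl)

instance : HasZeroObject (DGMod A) := ⟨⟨zero A, isZero_zero A⟩⟩

/-- The direct sum of two DG modules. -/
def prod (M N : DGMod A) : DGMod A where
  X q := M.X q × N.X q
  d h := (M.d h).prodMap (N.d h)
  d_d h h' z := by ext <;> simp [M.d_d, N.d_d]
  smul h := AddMonoidHom.mk' (fun a => (M.smul h a).prodMap (N.smul h a))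
    (fun a b => by ext <;> simp)
  one_smul h z := by ext <;> simp [M.one_smul, N.one_smul]
  mul_smul hs hsn hr hn a b z := by
    ext
    · simpa using M.mul_smul hs hsn hr hn a b z.1
    · simpa using N.mul_smul hs hsn hr hn a b z.2
  leibniz hp hq hn h h₁ h₂ a z := by
    ext
    · simpa using M.leibniz hp hq hn h h₁ h₂ a z.1
    · simpa using N.leibniz hp hq hn h h₁ h₂ a z.2

/-- The biproduct bicone on the direct sum of two DG modules. -/
def prodBicone (M N : DGMod A) : BinaryBicone M N where
  pt := prod M N
  fst := ⟨fun _ => AddMonoidHom.fst _ _, fun _ _ => rfl, fun _ _ _ => rfl⟩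
  snd := ⟨fun _ => AddMonoidHom.snd _ _, fun _ _ => rfl, fun _ _ _ => rfl⟩
  inl := ⟨fun _ => AddMonoidHom.inl _ _,
    fun h _ => Prod.ext rfl (map_zero (N.d h)).symm,
    fun h a _ => Prod.ext rfl (map_zero (N.smul h a)).symm⟩
  inr := ⟨fun _ => AddMonoidHom.inr _ _,
    fun h _ => Prod.ext (map_zero (M.d h)).symm rfl,
    fun h a _ => Prod.ext (map_zero (M.smul h a)).symm rfl⟩

instance : HasBinaryBiproducts (DGMod A) where
  has_binary_biproduct M N := HasBinaryBiproduct.mk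
    ⟨prodBicone M N, isBinaryBilimitOfTotal _ (by
      ext q x
      exact Prod.fst_add_snd x)⟩

instance : HasFiniteProducts (DGMod A) := hasFiniteProducts_of_has_binary_and_terminal

/-! ### Cohomology and quasi-isomorphisms -/

/-- The cocycles of degree `q`. -/
def cocycles (M : DGMod A) (q : ℤ) : AddSubgroup (M.X q) := (M.d (rfl : q + 1 = q + 1)).ker

/-- The coboundaries of degree `q`. -/
def coboundaries (M : DGMod A) (q : ℤ) : AddSubgroup (M.X q) :=
  (M.d (show (q - 1) + 1 = q by lia)).range

/-- The cohomology group `H^q(M)`. -/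
abbrev H (M : DGMod A) (q : ℤ) : Type u :=
  M.cocycles q ⧸ (M.coboundaries q).addSubgroupOf (M.cocycles q)

/-- The map induced by a DG morphism on cocycles. -/
def cocyclesMap {M N : DGMod A} (φ : M ⟶ N) (q : ℤ) : M.cocycles q →+ N.cocycles q :=
  ((Hom.f φ q).comp (M.cocycles q).subtype).codRestrict _ (fun x => by
    have hx : M.d (rfl : q + 1 = q + 1) x.1 = 0 := x.2
    change N.d (rfl : q + 1 = q + 1) (Hom.f φ q x.1) = 0
    rw [← Hom.comm φ, hx, map_zero])

/-- The map `H^q(φ)`. -/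
def HMap {M N : DGMod A} (φ : M ⟶ N) (q : ℤ) : M.H q →+ N.H q :=
  QuotientAddGroup.map _ _ (cocyclesMap φ q) (by
    rintro x ⟨y, hy⟩
    exact ⟨Hom.f φ _ y, by rw [← Hom.comm φ, hy]; rfl⟩)

/-- The cohomology functor `H^q`. -/
def cohomology (A : DGAlg k) (q : ℤ) : DGMod A ⥤ AddCommGrpCat.{u} where
  obj M := AddCommGrpCat.of (M.H q)
  map φ := AddCommGrpCat.ofHom (HMap φ q)
  map_id M := by
    ext x; rfl
  map_comp φ ψ := by
    ext x; rfl

instance (q : ℤ) : (cohomology A q).Additive where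
  map_add {M N φ ψ} := by
    ext x; obtain ⟨x, rfl⟩ := QuotientAddGroup.mk_surjective x; rfl

/-- The quasi-isomorphisms. -/
def quasiIso (A : DGAlg k) : MorphismProperty (DGMod A) :=
  fun _ _ φ => ∀ q : ℤ, IsIso ((cohomology A q).map φ)

instance : (quasiIso A).ContainsIdentities := ⟨fun M q => by
  rw [CategoryTheory.Functor.map_id]; infer_instance⟩

instance : (quasiIso A).RespectsIso :=
  MorphismProperty.RespectsIso.of_respects_arrow_iso _ (fun _ _ e hφ q =>
    ((MorphismProperty.isomorphisms _).arrow_mk_iso_iff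
      ((cohomology A q).mapArrow.mapIso e)).1 (hφ q))

instance : (quasiIso A).IsStableUnderFiniteProducts where
  isStableUnderProductsOfShape J _ :=
    { condition := fun X₁ X₂ c₁ c₂ hc₁ hc₂ f hf α hα q => by
        have : HasFiniteBiproducts (DGMod A) := HasFiniteBiproducts.of_hasFiniteProducts
        have : PreservesFiniteProducts (cohomology A q) :=
          ⟨fun _ => preservesProductsOfShape_of_preservesBiproductsOfShape _⟩
        have : PreservesLimitsOfShape (Discrete J) (cohomology A q) := inferInstance
        have (j : Discrete J) : IsIso ((Functor.whiskerRight f (cohomology A q)).app j) := hf j q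
        have := NatIso.isIso_of_isIso_app (Functor.whiskerRight f (cohomology A q))
        let e := (isLimitOfPreserves (cohomology A q) hc₁).conePointsIsoOfNatIso
          (isLimitOfPreserves (cohomology A q) hc₂)
          (asIso (Functor.whiskerRight f (cohomology A q)))
        have he : (cohomology A q).map α = e.hom := by
          refine (isLimitOfPreserves (cohomology A q) hc₂).hom_ext (fun j => ?_)
          have h₁ := (isLimitOfPreserves (cohomology A q) hc₁).conePointsIsoOfNatIso_hom_comp
            (isLimitOfPreserves (cohomology A q) hc₂)
            (asIso (Functor.whiskerRight f (cohomology A q))) j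
          refine Eq.trans ?_ h₁.symm
          have h₂ := congrArg (cohomology A q).map (hα j)
          simpa using h₂
        rw [he]
        infer_instance }

lemma isIso_cohomology_map_iff {M N : DGMod A} (φ : M ⟶ N) (q : ℤ) :
    IsIso ((cohomology A q).map φ) ↔
      (∀ x : M.X q, M.d rfl x = 0 → Hom.f φ q x ∈ N.coboundaries q → x ∈ M.coboundaries q) ∧
      (∀ y : N.X q, N.d rfl y = 0 → ∃ x : M.X q, M.d rfl x = 0 ∧
        Hom.f φ q x - y ∈ N.coboundaries q) := by
  rw [ConcreteCategory.isIso_iff_bijective]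
  change Function.Bijective (HMap φ q) ↔ _
  refine and_congr ?_ ?_
  · rw [injective_iff_map_eq_zero]
    constructor
    · intro h x hx hb
      have := h (QuotientAddGroup.mk ⟨x, hx⟩) ((QuotientAddGroup.eq_zero_iff _).2 hb)
      exact (QuotientAddGroup.eq_zero_iff (⟨x, hx⟩ : M.cocycles q)).1 this
    · intro h x hx
      obtain ⟨x, rfl⟩ := QuotientAddGroup.mk_surjective x
      exact (QuotientAddGroup.eq_zero_iff _).2 (h x.1 x.2 
        ((QuotientAddGroup.eq_zero_iff (cocyclesMap φ q x)).1 hx))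
  · constructor
    · intro h y hy
      obtain ⟨x, hx⟩ := h (QuotientAddGroup.mk ⟨y, hy⟩)
      obtain ⟨x, rfl⟩ := QuotientAddGroup.mk_surjective x
      refine ⟨x.1, x.2, ?_⟩
      have := (QuotientAddGroup.eq_iff_sub_mem).1 hx
      exact this
    · intro h y
      obtain ⟨y, rfl⟩ := QuotientAddGroup.mk_surjective y
      obtain ⟨x, hx, hxy⟩ := h y.1 y.2
      exact ⟨QuotientAddGroup.mk ⟨x, hx⟩, (QuotientAddGroup.eq_iff_sub_mem).2 hxy⟩

lemma quasiIso_shiftFun (i : ℤ) {M N : DGMod A} (φ : M ⟶ N) (hφ : quasiIso A φ) :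
    quasiIso A ((shiftFun A i).map φ) := by
  have hb (P : DGMod A) (q : ℤ) (x : P.X (q + i)) :
      x ∈ (P.shift i).coboundaries q ↔ x ∈ P.coboundaries (q + i) := by
    constructor
    · rintro ⟨y, hy⟩
      have hy' : i.negOnePow • P.d (show q - 1 + i + 1 = q + i by lia) y = x := hy
      refine ⟨i.negOnePow • P.cast (by lia) (show P.X (q - 1 + i) from y), ?_⟩
      rw [map_units_smul, d_cast, hy']
    · rintro ⟨y, hy⟩
      refine ⟨i.negOnePow • P.cast (show q + i - 1 = q - 1 + i by lia) y, ?_⟩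
      refine (map_units_smul ((P.shift i).d (show q - 1 + 1 = q by lia)) _ _).trans ?_
      change i.negOnePow • i.negOnePow • P.d (show q - 1 + i + 1 = q + i by lia) _ = x
      rw [smul_smul, d_cast, hy]
      simp
  have hz (P : DGMod A) (q : ℤ) (x : P.X (q + i)) :
      (P.shift i).d (rfl : q + 1 = q + 1) x = 0 ↔ P.d (rfl : q + i + 1 = q + i + 1) x = 0 := by
    change i.negOnePow • P.d (show q + i + 1 = q + 1 + i by lia) x = 0 ↔ _
    rw [smul_eq_zero_iff_eq, ← cast_d P rfl (show q + i + 1 = q + 1 + i by lia) x]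
    generalize P.d (rfl : q + i + 1 = q + i + 1) x = z
    generalize_proofs e
    revert z e
    generalize q + 1 + i = t
    rintro z rfl
    rfl
  intro q
  obtain ⟨h₁, h₂⟩ := (isIso_cohomology_map_iff φ (q + i)).1 (hφ (q + i))
  refine (isIso_cohomology_map_iff _ q).2 ⟨fun x hx hxb => ?_, fun y hy => ?_⟩
  · exact (hb M q x).2 (h₁ x ((hz M q x).1 hx) ((hb N q _).1 hxb))
  · obtain ⟨x, hx, hxy⟩ := h₂ y ((hz N q y).1 hy)
    exact ⟨x, (hz M q x).2 hx, (hb N q _).2 hxy⟩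

end DGMod

/-! ### The derived category -/

/-- The derived category `D(A)`: DG modules, with the quasi-isomorphisms inverted. -/
abbrev DerivedCat (A : DGAlg k) := (DGMod.quasiIso A).Localization

namespace DerivedCat

open DGMod

variable {A : DGAlg k}

/-- The localization functor from DG modules to the derived category. -/
abbrev Q (A : DGAlg k) : DGMod A ⥤ DerivedCat A := (quasiIso A).Q

/-- The binary product property of `M ⊞ N` in the derived category. -/
def isLimitQ (M N : DGMod A) : IsLimit (BinaryFan.mk
    ((Q A).map (biprod.fst : M ⊞ N ⟶ M)) ((Q A).map (biprod.snd : M ⊞ N ⟶ N))) :=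
  mapIsLimitOfPreservesOfIsLimit (Q A) _ _ (BinaryBiproduct.isLimit M N)

/-- The morphism to `M ⊞ N` in the derived category with given components. -/
def liftQ {X : DerivedCat A} {M N : DGMod A} (f : X ⟶ (Q A).obj M) (g : X ⟶ (Q A).obj N) :
    X ⟶ (Q A).obj (M ⊞ N) :=
  (isLimitQ M N).lift (BinaryFan.mk f g)

lemma liftQ_fst {X : DerivedCat A} {M N : DGMod A} (f : X ⟶ (Q A).obj M)
    (g : X ⟶ (Q A).obj N) : liftQ f g ≫ (Q A).map biprod.fst = f :=
  (isLimitQ M N).fac (BinaryFan.mk f g) ⟨WalkingPair.left⟩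

lemma liftQ_snd {X : DerivedCat A} {M N : DGMod A} (f : X ⟶ (Q A).obj M)
    (g : X ⟶ (Q A).obj N) : liftQ f g ≫ (Q A).map biprod.snd = g :=
  (isLimitQ M N).fac (BinaryFan.mk f g) ⟨WalkingPair.right⟩

/-- The sum of two morphisms in the derived category. -/
def addQ {X : DerivedCat A} {M : DGMod A} (f g : X ⟶ (Q A).obj M) : X ⟶ (Q A).obj M :=
  liftQ f g ≫ (Q A).map (biprod.fst + biprod.snd)

lemma addQ_map {X : DerivedCat A} {L M : DGMod A} (s : X ⟶ (Q A).obj L) (u v : L ⟶ M) :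
    addQ (s ≫ (Q A).map u) (s ≫ (Q A).map v) = s ≫ (Q A).map (u + v) := by
  have : liftQ (s ≫ (Q A).map u) (s ≫ (Q A).map v) = s ≫ (Q A).map (biprod.lift u v) := by
    refine BinaryFan.IsLimit.hom_ext (isLimitQ M M) ?_ ?_
    · refine (liftQ_fst _ _).trans ?_
      simp [← Functor.map_comp]
    · refine (liftQ_snd _ _).trans ?_
      simp [← Functor.map_comp]
  rw [addQ, this, Category.assoc, ← Functor.map_comp]
  simp [biprod.lift_eq]

lemma comp_addQ {X Y : DerivedCat A} {M : DGMod A} (h : Y ⟶ X) (f g : X ⟶ (Q A).obj M) :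
    h ≫ addQ f g = addQ (h ≫ f) (h ≫ g) := by
  have := addQ_map (h ≫ liftQ f g) (biprod.fst : M ⊞ M ⟶ M) biprod.snd
  rw [Category.assoc, Category.assoc, liftQ_fst, liftQ_snd] at this
  rw [this, addQ, Category.assoc]

/-- The sum of two morphisms in the derived category, for an arbitrary target. -/
def addD {X Y : DerivedCat A} (f g : X ⟶ Y) : X ⟶ Y :=
  addQ (M := (Localization.Construction.objEquiv _).symm Y) f g

lemma addD_comp {X Y Z : DerivedCat A} (f g : X ⟶ Y) (h : Y ⟶ Z) :
    addD f g ≫ h = addD (f ≫ h) (g ≫ h) := by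
  let P : MorphismProperty (DerivedCat A) := fun Y Z h =>
    ∀ (X : DerivedCat A) (f g : X ⟶ Y), addD f g ≫ h = addD (f ≫ h) (g ≫ h)
  have : P.IsStableUnderComposition := ⟨fun u v hu hv X f g => by
    rw [← Category.assoc, hu, hv, Category.assoc, Category.assoc]⟩
  have hP : P = ⊤ := by
    refine Localization.Construction.morphismProperty_eq_top' P (fun M N u X f g => ?_)
      (fun Y Z e he X f g => ?_)
    · obtain ⟨L, s, v, w, rfl, rfl⟩ : ∃ (L : DGMod A) (s : X ⟶ (Q A).obj L) (v w : L ⟶ M),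
          f = s ≫ (Q A).map v ∧ g = s ≫ (Q A).map w :=
        ⟨_, liftQ f g, biprod.fst, biprod.snd, (liftQ_fst f g).symm, (liftQ_snd f g).symm⟩
      refine (congrArg (· ≫ (Q A).map u) (addQ_map s v w)).trans ?_
      have h := addQ_map s (v ≫ u) (w ≫ u)
      rw [← Preadditive.add_comp, Functor.map_comp, Functor.map_comp, Functor.map_comp] at h
      simp only [← Category.assoc] at h
      exact h.symm
    · have := he X (f ≫ e.inv) (g ≫ e.inv)
      simp only [Category.assoc, Iso.inv_hom_id, Category.comp_id] at this
      rw [← this, Category.assoc, Iso.hom_inv_id, Category.comp_id]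
  have : P h := by rw [hP]; trivial
  exact this X f g

/-- The zero morphism in the derived category. -/
def zeroQ (X : DerivedCat A) (M : DGMod A) : X ⟶ (Q A).obj M :=
  ((isZero_zero A).isTerminal.isTerminalObj (Q A)).from X ≫ (Q A).map 0

lemma comp_map_zero {X : DerivedCat A} {L M : DGMod A} (s : X ⟶ (Q A).obj L) :
    s ≫ (Q A).map (0 : L ⟶ M) = zeroQ X M := by
  have : (0 : L ⟶ M) = (0 : L ⟶ zero A) ≫ (0 : zero A ⟶ M) := by simp
  rw [this, Functor.map_comp, ← Category.assoc, zeroQ]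
  congr 1
  exact ((isZero_zero A).isTerminal.isTerminalObj (Q A)).hom_ext _ _

lemma exists_rep₂ {X : DerivedCat A} {M : DGMod A} (f g : X ⟶ (Q A).obj M) :
    ∃ (L : DGMod A) (s : X ⟶ (Q A).obj L) (u v : L ⟶ M),
      f = s ≫ (Q A).map u ∧ g = s ≫ (Q A).map v :=
  ⟨_, liftQ f g, biprod.fst, biprod.snd, (liftQ_fst f g).symm, (liftQ_snd f g).symm⟩

lemma exists_rep₃ {X : DerivedCat A} {M : DGMod A} (f g h : X ⟶ (Q A).obj M) :
    ∃ (L : DGMod A) (s : X ⟶ (Q A).obj L) (u v w : L ⟶ M),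
      f = s ≫ (Q A).map u ∧ g = s ≫ (Q A).map v ∧ h = s ≫ (Q A).map w := by
  refine ⟨_, liftQ (liftQ f g) h, biprod.fst ≫ biprod.fst, biprod.fst ≫ biprod.snd, biprod.snd,
    ?_, ?_, (liftQ_snd _ _).symm⟩
  · rw [Functor.map_comp, ← Category.assoc, liftQ_fst, liftQ_fst]
  · rw [Functor.map_comp, ← Category.assoc, liftQ_fst, liftQ_snd]

/-- The abelian group of morphisms `X ⟶ M` in the derived category. -/
@[reducible]
def homGroupQ (X : DerivedCat A) (M : DGMod A) : AddCommGroup (X ⟶ (Q A).obj M) where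
  add := addQ
  zero := zeroQ X M
  neg f := f ≫ (Q A).map (-𝟙 M)
  add_assoc f g h := by
    obtain ⟨L, s, u, v, w, rfl, rfl, rfl⟩ := exists_rep₃ f g h
    change addQ (addQ _ _) _ = addQ _ (addQ _ _)
    simp only [addQ_map, add_assoc]
  zero_add f := by
    change addQ (zeroQ X M) f = f
    have := addQ_map f 0 (𝟙 M)
    simpa [comp_map_zero] using this
  add_zero f := by
    change addQ f (zeroQ X M) = f
    have := addQ_map f (𝟙 M) 0
    simpa [comp_map_zero] using this
  add_comm f g := by
    obtain ⟨L, s, u, v, rfl, rfl⟩ := exists_rep₂ f g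
    change addQ _ _ = addQ _ _
    simp only [addQ_map, add_comm]
  neg_add_cancel f := by
    change addQ (f ≫ (Q A).map (-𝟙 M)) f = zeroQ X M
    have := addQ_map f (-𝟙 M) (𝟙 M)
    simpa [comp_map_zero] using this
  nsmul := @nsmulRec _ ⟨zeroQ X M⟩ ⟨addQ⟩
  zsmul := @zsmulRec _ ⟨zeroQ X M⟩ ⟨addQ⟩ ⟨fun f => f ≫ (Q A).map (-𝟙 M)⟩
    (@nsmulRec _ ⟨zeroQ X M⟩ ⟨addQ⟩)

/-- The additive structure on the derived category for which `Q` is additive. -/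
instance : Preadditive (DerivedCat A) where
  homGroup X Y := homGroupQ X ((Localization.Construction.objEquiv _).symm Y)
  add_comp _ _ _ f g h := addD_comp f g h
  comp_add _ _ Z h f g := comp_addQ (M := (Localization.Construction.objEquiv _).symm Z) h f g

instance : (Q A).Additive where
  map_add {M N u v} := by
    have := addQ_map (𝟙 ((Q A).obj M)) u v
    simp only [Category.id_comp] at this
    exact this.symm

/-- The suspension functor `Σ^i` on the derived category. -/
def shift (A : DGAlg k) (i : ℤ) : DerivedCat A ⥤ DerivedCat A :=
  Localization.lift (shiftFun A i ⋙ Q A)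
    (fun _ _ φ hφ => Localization.inverts (Q A) (quasiIso A) _ (quasiIso_shiftFun i φ hφ)) (Q A)

/-- The suspension functors on DG modules and on the derived category are compatible. -/
def shiftIso (A : DGAlg k) (i : ℤ) : Q A ⋙ shift A i ≅ shiftFun A i ⋙ Q A :=
  Localization.fac _ _ _

/-- The cohomology functor `H^q` on the derived category. -/
def cohomology (A : DGAlg k) (q : ℤ) : DerivedCat A ⥤ AddCommGrpCat.{u} :=
  Localization.lift (DGMod.cohomology A q) (fun _ _ φ (hφ : quasiIso A φ) => hφ q) (Q A)

/-- The exact triangles `L ⟶ M ⟶ N ⟶ Σ L` of the derived category: those isomorphic to the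
triangle `X ⟶ Y ⟶ Cone φ ⟶ Σ X` of some DG morphism `φ : X ⟶ Y`. -/
def IsExactTriangle {L M N : DerivedCat A} (f : L ⟶ M) (g : M ⟶ N)
    (h : N ⟶ (shift A 1).obj L) : Prop :=
  ∃ (X Y : DGMod A) (φ : X ⟶ Y) (a : L ≅ (Q A).obj X) (b : M ≅ (Q A).obj Y)
    (c : N ≅ (Q A).obj (cone φ)),
    f ≫ b.hom = a.hom ≫ (Q A).map φ ∧
    g ≫ c.hom = b.hom ≫ (Q A).map (coneInl φ) ∧
    h ≫ (shift A 1).map a.hom ≫ (shiftIso A 1).hom.app X = c.hom ≫ (Q A).map (coneSnd φ)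

/-! ### Ghosts -/

/-- Ghost morphisms: those that vanish on cohomology. -/
def IsGhost {M N : DerivedCat A} (f : M ⟶ N) : Prop :=
  ∀ q : ℤ, (cohomology A q).map f = 0

/-- The composites of `n` ghosts. For `n = 0` these are the identities. -/
inductive IsGhostComposite : ℕ → ∀ {M N : DerivedCat A}, (M ⟶ N) → Prop
  | id (M : DerivedCat A) : IsGhostComposite 0 (𝟙 M)
  | comp {n : ℕ} {M N P : DerivedCat A} (f : M ⟶ N) (g : N ⟶ P) :
      IsGhostComposite n f → IsGhost g → IsGhostComposite (n + 1) (f ≫ g)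

/-- Every composite of `n + 1` ghosts from `M` is zero, and some composite of `n` ghosts from `M`
is not. -/
def HasGhostLength (M : DerivedCat A) (n : ℕ) : Prop :=
  (∀ (N : DerivedCat A) (f : M ⟶ N), IsGhostComposite (n + 1) f → f = 0) ∧
    ∃ (N : DerivedCat A) (f : M ⟶ N), IsGhostComposite n f ∧ f ≠ 0

open Classical in
/-- The ghost length: `-1` for a zero object, otherwise the `n` with `HasGhostLength M n`, and
`∞` if there is no such `n`. -/
def ghostLength (M : DerivedCat A) : EReal :=
  if IsZero M then -1 else ⨅ (n : ℕ) (_ : HasGhostLength M n), (n : EReal)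

/-! ### Compact objects, levels and dimensions -/

/-- Compact objects: `Hom(M, -)`, as a functor to abelian groups, preserves all coproducts. -/
def compact (A : DGAlg k) : ObjectProperty (DerivedCat A) := fun M =>
  ∀ J : Type u, PreservesColimitsOfShape (Discrete J) (preadditiveCoyoneda.obj (Opposite.op M))

/-- The closure of a class of objects under isomorphisms and direct summands. -/
inductive smd (S : ObjectProperty (DerivedCat A)) : ObjectProperty (DerivedCat A)
  | of (M : DerivedCat A) : S M → smd S M
  | iso (M N : DerivedCat A) : (M ≅ N) → smd S M → smd S N
  | summand (M N : DerivedCat A) (b : BinaryBicone M N) : b.IsBilimit → smd S b.pt → smd S M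

/-- The closure of a class of objects under isomorphisms, finite direct sums and all
suspensions. -/
inductive addCl (S : ObjectProperty (DerivedCat A)) : ObjectProperty (DerivedCat A)
  | of (M : DerivedCat A) : S M → addCl S M
  | iso (M N : DerivedCat A) : (M ≅ N) → addCl S M → addCl S N
  | zero (M : DerivedCat A) : IsZero M → addCl S M
  | sum (M N : DerivedCat A) (b : BinaryBicone M N) :
      b.IsBilimit → addCl S M → addCl S N → addCl S b.pt
  | shift (M : DerivedCat A) (i : ℤ) : addCl S M → addCl S ((DerivedCat.shift A i).obj M)

/-- `S ⋆ T`: the `M` in an exact triangle `L ⟶ M ⟶ N ⟶ Σ L` with `L` in `S` and `N` in `T`. -/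
def star (S T : ObjectProperty (DerivedCat A)) : ObjectProperty (DerivedCat A) := fun M =>
  ∃ (L N : DerivedCat A) (f : L ⟶ M) (g : M ⟶ N) (h : N ⟶ (shift A 1).obj L),
    S L ∧ T N ∧ IsExactTriangle f g h

/-- `⟨S⟩_n`: the zero objects for `n = 0`, then `⟨S⟩_1 = smd (addCl S)` and
`⟨S⟩_n = smd (⟨S⟩_{n-1} ⋆ ⟨S⟩_1)`. -/
def thick (S : ObjectProperty (DerivedCat A)) : ℕ → ObjectProperty (DerivedCat A)
  | 0 => fun M => IsZero M
  | 1 => smd (addCl S)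
  | n + 2 => smd (star (thick S (n + 1)) (smd (addCl S)))

/-- `⟨A⟩_n`. -/
def thickSelf (A : DGAlg k) (n : ℕ) : ObjectProperty (DerivedCat A) :=
  thick (fun M => M = (Q A).obj (DGMod.self A)) n

/-- The `A`-level of `M`: the least `n` with `M` in `⟨A⟩_n`, and `∞` if there is none. -/
def level (M : DerivedCat A) : ℕ∞ := ⨅ (n : ℕ) (_ : thickSelf A n M), (n : ℕ∞)

end DerivedCat

namespace DGAlg

/-- The left ghost dimension: the supremum of the ghost lengths of the compact objects. -/
def leftGhostDim (A : DGAlg k) : EReal :=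
  ⨆ (M : DerivedCat A) (_ : DerivedCat.compact A M), DerivedCat.ghostLength M

/-- The Rouquier dimension: the least `n` such that `⟨A⟩_n` is the class of all compact objects,
and `∞` if there is none. -/
def rouquierDim (A : DGAlg k) : ℕ∞ :=
  ⨅ (n : ℕ) (_ : DerivedCat.thickSelf A n = DerivedCat.compact A), (n : ℕ∞)

end DGAlg

end

/-!
Since `Hom(Σⁱ A, -)` is cohomology in degree `-i`, every ghost out of an object of `⟨A⟩₁` vanishes,
and by induction along exact triangles every composite of `n` ghosts out of an object of `⟨A⟩ₙ`
vanishes.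

Conversely, start with `0 ⟶ M` and repeatedly kill the cohomology of the cone by attaching
suspensions of `A`. After `n` steps this gives `F ⟶ M` with `F` an iterated extension of `n` direct
sums of suspensions of `A`, such that the inclusion of `M` into the cone of `F ⟶ M` is a composite
of `n` ghosts. If such composites out of `M` vanish, then `id_M` factors through `F`. If `M` is also
compact, then each of the `n` direct sums can be replaced by a finite one, so `id_M` factors through
an object of `⟨A⟩ₙ`, that is, `M` is a direct summand of an object of `⟨A⟩ₙ`.

Thus for compact `M` membership in `⟨A⟩ₙ` is the vanishing of all composites of `n` ghosts out of
`M`, and since the objects of `⟨A⟩ₙ` are compact, both equalities follow.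
-/

noncomputable section

variable {k : Type u} [Field k]

namespace DGMod

variable {A : DGAlg k}

/-! ### Cocycles, coboundaries and acyclic DG modules -/

lemma mem_coboundaries_iff {M : DGMod A} {p q : ℤ} (h : p + 1 = q) {x : M.X q} :
    x ∈ M.coboundaries q ↔ ∃ y : M.X p, M.d h y = x := by
  obtain rfl : p = q - 1 := by lia
  exact Iff.rfl

lemma d_mem_coboundaries (M : DGMod A) {p q : ℤ} (h : p + 1 = q) (x : M.X p) :
    M.d h x ∈ M.coboundaries q :=
  (mem_coboundaries_iff h).2 ⟨x, rfl⟩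

lemma cohomology_map_eq_zero_iff {M N : DGMod A} (φ : M ⟶ N) (q : ℤ) :
    (cohomology A q).map φ = 0 ↔
      ∀ x : M.X q, M.d rfl x = 0 → Hom.f φ q x ∈ N.coboundaries q := by
  constructor
  · intro h x hx
    have hx' := congrArg (fun f => f.hom (QuotientAddGroup.mk ⟨x, hx⟩)) h
    exact (QuotientAddGroup.eq_zero_iff (cocyclesMap φ q ⟨x, hx⟩)).1 hx'
  · intro h
    ext x
    obtain ⟨x, rfl⟩ := QuotientAddGroup.mk_surjective x
    exact (QuotientAddGroup.eq_zero_iff (cocyclesMap φ q x)).2 (h x.1 x.2)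

/-- A DG module without cohomology. -/
def Acyclic (M : DGMod A) : Prop :=
  ∀ (q : ℤ) (x : M.X q), M.d rfl x = 0 → x ∈ M.coboundaries q

lemma Acyclic.exists_d_eq {M : DGMod A} (hM : M.Acyclic) {p q : ℤ} (h : p + 1 = q) {x : M.X q}
    (hx : M.d rfl x = 0) : ∃ y : M.X p, M.d h y = x :=
  (mem_coboundaries_iff h).1 (hM q x hx)

lemma quasiIso_iff {M N : DGMod A} (φ : M ⟶ N) : quasiIso A φ ↔ ∀ q : ℤ,
    (∀ x : M.X q, M.d rfl x = 0 → Hom.f φ q x ∈ N.coboundaries q → x ∈ M.coboundaries q) ∧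
      (∀ y : N.X q, N.d rfl y = 0 → ∃ x : M.X q, M.d rfl x = 0 ∧
        Hom.f φ q x - y ∈ N.coboundaries q) :=
  forall_congr' fun q => isIso_cohomology_map_iff φ q

instance : (quasiIso A).IsMultiplicative where
  comp_mem f g hf hg q := by
    have := hf q
    have := hg q
    rw [Functor.map_comp]
    infer_instance

lemma quasiIso_zero_of_acyclic {M : DGMod A} (hM : M.Acyclic) :
    quasiIso A (0 : M ⟶ zero A) :=
  (quasiIso_iff _).2 fun _ => ⟨fun _ hx _ => hM _ _ hx, fun _ _ => ⟨0, map_zero _, zero_mem _⟩⟩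

lemma Acyclic.shift {M : DGMod A} (hM : M.Acyclic) (i : ℤ) :
    ((shiftFun A i).obj M).Acyclic := fun q x hx =>
  ((quasiIso_iff _).1 (quasiIso_shiftFun i _ (quasiIso_zero_of_acyclic hM)) q).1 x hx
    (show (0 : PUnit) ∈ _ from zero_mem _)

/-! ### Short exact sequences -/

/-- Degreewise short exact sequences of DG modules. -/
structure ShortExact {L M N : DGMod A} (i : L ⟶ M) (p : M ⟶ N) : Prop where
  injective : ∀ q, Function.Injective (Hom.f i q)
  surjective : ∀ q, Function.Surjective (Hom.f p q)
  comp_eq_zero : i ≫ p = 0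
  exact : ∀ (q : ℤ) (x : M.X q), Hom.f p q x = 0 → ∃ y, Hom.f i q y = x

namespace ShortExact

variable {L M N : DGMod A} {i : L ⟶ M} {p : M ⟶ N}

lemma comp_apply (h : ShortExact i p) {q : ℤ} (x : L.X q) : Hom.f p q (Hom.f i q x) = 0 :=
  congrArg (fun φ => Hom.f φ q x) h.comp_eq_zero

lemma d_eq_zero_of_f_d_eq_zero (h : ShortExact i p) {q q' : ℤ} (e : q + 1 = q') {x : L.X q}
    (hx : M.d e (Hom.f i q x) = 0) : L.d e x = 0 :=
  h.injective _ (by rw [Hom.comm, hx, map_zero])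

lemma quasiIso_left (h : ShortExact i p) (hN : N.Acyclic) : quasiIso A i := by
  refine (quasiIso_iff i).2 fun q => ?_
  obtain ⟨r, hr⟩ : ∃ r, r + 1 = q := ⟨q - 1, by lia⟩
  obtain ⟨t, ht⟩ : ∃ t, t + 1 = r := ⟨r - 1, by lia⟩
  refine ⟨fun x _ hb => ?_, fun y hy => ?_⟩
  · obtain ⟨m, hm⟩ := (mem_coboundaries_iff hr).1 hb
    obtain ⟨n, hn⟩ := hN.exists_d_eq ht (x := Hom.f p r m) (by
      subst hr
      rw [← Hom.comm, hm, h.comp_apply])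
    obtain ⟨m', rfl⟩ := h.surjective _ n
    obtain ⟨l, hl⟩ := h.exact _ (m - M.d ht m') (by rw [map_sub, Hom.comm, hn, sub_self])
    refine (mem_coboundaries_iff hr).2 ⟨l, h.injective _ ?_⟩
    rw [Hom.comm, hl, map_sub, M.d_d, hm, sub_zero]
  · obtain ⟨n, hn⟩ := hN.exists_d_eq hr (x := Hom.f p q y) (by rw [← Hom.comm, hy, map_zero])
    obtain ⟨m, rfl⟩ := h.surjective _ n
    obtain ⟨l, hl⟩ := h.exact _ (y - M.d hr m) (by rw [map_sub, Hom.comm, hn, sub_self])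
    refine ⟨l, h.d_eq_zero_of_f_d_eq_zero rfl ?_, ?_⟩
    · rw [hl, map_sub, M.d_d, hy, sub_zero]
    · rw [hl, sub_sub_cancel_left]
      exact neg_mem (M.d_mem_coboundaries hr m)

lemma quasiIso_right (h : ShortExact i p) (hL : L.Acyclic) : quasiIso A p := by
  refine (quasiIso_iff p).2 fun q => ?_
  obtain ⟨r, hr⟩ : ∃ r, r + 1 = q := ⟨q - 1, by lia⟩
  refine ⟨fun x hx hb => ?_, fun n hn => ?_⟩
  · obtain ⟨n, hn⟩ := (mem_coboundaries_iff hr).1 hb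
    obtain ⟨m, rfl⟩ := h.surjective _ n
    obtain ⟨l, hl⟩ := h.exact _ (x - M.d hr m) (by rw [map_sub, Hom.comm, hn, sub_self])
    obtain ⟨l', rfl⟩ := hL.exists_d_eq hr (h.d_eq_zero_of_f_d_eq_zero rfl (x := l) (by
      rw [hl, map_sub, M.d_d, hx, sub_zero]))
    refine (mem_coboundaries_iff hr).2 ⟨m + Hom.f i _ l', ?_⟩
    rw [map_add, ← Hom.comm, hl, add_sub_cancel]
  · obtain ⟨m, rfl⟩ := h.surjective _ n
    obtain ⟨l, hl⟩ := h.exact _ (M.d rfl m) (by rw [Hom.comm, hn])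
    obtain ⟨l', rfl⟩ := hL.exists_d_eq rfl (h.d_eq_zero_of_f_d_eq_zero rfl (x := l) (by
      rw [hl, M.d_d]))
    refine ⟨m - Hom.f i _ l', ?_, ?_⟩
    · rw [map_sub, ← Hom.comm, hl, sub_self]
    · rw [map_sub, h.comp_apply, sub_zero, sub_self]
      exact zero_mem _

end ShortExact

/-- Null homotopies `φ = d s + s d` through an `A`-linear map `s` of degree `-1`; linearity is up
to the sign `(-1)^{|a|}`, as `s` passes the scalar. -/
structure NullHomotopy {M N : DGMod A} (φ : M ⟶ N) where
  s : ∀ {q q' : ℤ}, q' + 1 = q → (M.X q →+ N.X q')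
  comm : ∀ {q q' q'' : ℤ} (h : q' + 1 = q) (h' : q + 1 = q'') (x : M.X q),
    Hom.f φ q x = N.d h (s h x) + s h' (M.d h' x)
  map_smul : ∀ {p q q' n n' : ℤ} (hq : q' + 1 = q) (hn : n' + 1 = n) (h : p + q = n)
    (h' : p + q' = n') (a : A.gr p) (x : M.X q),
    s hn (M.smul h a x) = p.negOnePow • N.smul h' a (s hq x)

namespace NullHomotopy

variable {M N P : DGMod A}

/-- The null homotopy of the zero morphism. -/
def zero (M N : DGMod A) : NullHomotopy (0 : M ⟶ N) where
  s _ := 0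
  comm _ _ _ := by simp
  map_smul _ _ _ _ _ _ := by simp

/-- The sum of null homotopies. -/
def add {φ ψ : M ⟶ N} (s : NullHomotopy φ) (t : NullHomotopy ψ) : NullHomotopy (φ + ψ) where
  s h := s.s h + t.s h
  comm h h' x := by
    simp only [add_f, s.comm h h', t.comm h h', AddMonoidHom.add_apply, map_add]
    abel
  map_smul hq hn h e a x := by simp [s.map_smul hq hn h e, t.map_smul hq hn h e]

/-- The negative of a null homotopy. -/
def neg {φ : M ⟶ N} (s : NullHomotopy φ) : NullHomotopy (-φ) where
  s h := -s.s h
  comm h h' x := by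
    simp only [neg_f, s.comm h h', neg_add_rev, AddMonoidHom.neg_apply, map_neg]
    abel
  map_smul hq hn h e a x := by simp [s.map_smul hq hn h e]

/-- Postcomposition of a null homotopy. -/
def compRight {φ : M ⟶ N} (s : NullHomotopy φ) (g : N ⟶ P) : NullHomotopy (φ ≫ g) where
  s {q q'} h := (Hom.f g q').comp (s.s h)
  comm h h' x := by simp [s.comm h h', Hom.comm g]
  map_smul hq hn h h' a x := by
    simp [s.map_smul hq hn h h', Hom.map_smul g]

/-- Precomposition of a null homotopy. -/
def compLeft {φ : N ⟶ P} (s : NullHomotopy φ) (g : M ⟶ N) : NullHomotopy (g ≫ φ) where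
  s {q q'} h := (s.s h).comp (Hom.f g q)
  comm h h' x := by simp [s.comm h h', Hom.comm g]
  map_smul hq hn h h' a x := by simp [s.map_smul hq hn h h', Hom.map_smul g]

/-- Transport of a null homotopy along an equality of morphisms. -/
def ofEq {φ ψ : M ⟶ N} (s : NullHomotopy φ) (h : φ = ψ) : NullHomotopy ψ where
  s := s.s
  comm := by subst h; exact s.comm
  map_smul := s.map_smul

end NullHomotopy

/-! ### Cones -/

section cone

variable {X Y Z : DGMod A}

lemma cone_d (φ : X ⟶ Y) {q q' : ℤ} (h : q + 1 = q') (z : (cone φ).X q) :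
    (cone φ).d h z = (Y.d h z.1 + Hom.f φ q' (X.cast h z.2),
      -X.d (show (q + 1) + 1 = q' + 1 by lia) z.2) := rfl

/-- The morphism out of a cone given by a morphism and a null homotopy. -/
def coneDesc (φ : X ⟶ Y) (g : Y ⟶ Z) (s : NullHomotopy (φ ≫ g)) : cone φ ⟶ Z where
  f q := (Hom.f g q).coprod (s.s rfl)
  comm {q q'} h z := by
    subst h
    have := s.comm (rfl : q + 1 = q + 1) rfl z.2
    rw [comp_f] at this
    change Hom.f g _ (Y.d rfl z.1 + Hom.f φ _ z.2) + s.s rfl (-X.d rfl z.2) =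
      Z.d rfl (Hom.f g _ z.1 + s.s rfl z.2)
    simp only [map_add, Hom.comm g, this, map_neg]
    abel
  map_smul {p q n} h a z := by
    change Hom.f g _ (Y.smul h a z.1) + s.s rfl (p.negOnePow • X.smul _ a z.2) =
      Z.smul h a (Hom.f g _ z.1 + s.s rfl z.2)
    simp [Hom.map_smul g, s.map_smul rfl rfl _ h, smul_smul]

lemma coneInl_coneDesc (φ : X ⟶ Y) (g : Y ⟶ Z) (s : NullHomotopy (φ ≫ g)) :
    coneInl φ ≫ coneDesc φ g s = g := by
  ext q x
  change Hom.f g q x + s.s rfl 0 = Hom.f g q x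
  simp

/-- The composite of a morphism with the inclusion into its cone is null homotopic. -/
def nullHomotopyConeInl (φ : X ⟶ Y) : NullHomotopy (φ ≫ coneInl φ) where
  s {q q'} h := (AddMonoidHom.inr (Y.X q') (X.X (q' + 1))).comp (X.cast h.symm)
  comm {q q' q''} h h' x := by
    subst h h'
    refine Prod.ext ?_ ?_
    · change Hom.f φ _ x = Y.d rfl 0 + Hom.f φ _ x + 0
      simp
    · change (0 : X.X _) = -X.d rfl x + X.d rfl x
      simp
  map_smul {p q q' n n'} hq hn h h' a x := by
    subst hq hn
    refine Prod.ext ?_ ?_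
    · change (0 : Y.X _) = p.negOnePow • Y.smul h' a 0
      simp
    · change X.smul h a x = p.negOnePow • p.negOnePow • X.smul h a x
      simp [smul_smul]

/-- The composite of the projection `Cone φ ⟶ Σ X` with `Σ φ` is null homotopic. -/
def nullHomotopyConeSnd (φ : X ⟶ Y) : NullHomotopy (coneSnd φ ≫ (shiftFun A 1).map φ) where
  s {q q'} h := (Y.cast h.symm).comp (AddMonoidHom.fst (Y.X q) (X.X (q + 1)))
  comm {q q' q''} h h' x := by
    subst h h'
    change Hom.f φ _ x.2 = (1 : ℤ).negOnePow • Y.d _ x.1 +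
      (Y.d _ x.1 + Hom.f φ _ (X.cast _ x.2))
    simp
  map_smul {p q q' n n'} hq hn h h' a x := by
    subst hq hn
    change Y.smul h a x.1 = p.negOnePow • (p * 1).negOnePow • Y.smul _ a x.1
    simp [smul_smul]

/-- The morphism of cones induced by a commutative square. -/
def coneMap {X' Y' : DGMod A} (φ : X ⟶ Y) (φ' : X' ⟶ Y') (a : X ⟶ X') (b : Y ⟶ Y')
    (w : φ ≫ b = a ≫ φ') : cone φ ⟶ cone φ' where
  f q := (Hom.f b q).prodMap (Hom.f a (q + 1))
  comm {q q'} h z := by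
    subst h
    have := congrArg (fun f => Hom.f f _ z.2) w
    simp only [comp_f] at this
    refine Prod.ext ?_ ?_
    · change Hom.f b _ (Y.d rfl z.1 + Hom.f φ _ z.2) = Y'.d rfl (Hom.f b _ z.1) +
        Hom.f φ' _ (Hom.f a _ z.2)
      rw [map_add, Hom.comm b, this]
    · change Hom.f a _ (-X.d rfl z.2) = -X'.d rfl (Hom.f a _ z.2)
      rw [map_neg, Hom.comm a]
  map_smul {p q n} h c z := by
    refine Prod.ext (Hom.map_smul b h c z.1) ?_
    exact (map_units_smul _ _ _).trans (congrArg _ (Hom.map_smul a _ c z.2))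

lemma coneInl_coneMap {X' Y' : DGMod A} (φ : X ⟶ Y) (φ' : X' ⟶ Y') (a : X ⟶ X') (b : Y ⟶ Y')
    (w : φ ≫ b = a ≫ φ') : coneInl φ ≫ coneMap φ φ' a b w = b ≫ coneInl φ' := by
  ext q x
  exact Prod.ext rfl (map_zero (Hom.f a (q + 1)))

lemma cone_d_eq_zero {φ : X ⟶ Y} {q : ℤ} {z : (cone φ).X q} :
    (cone φ).d rfl z = 0 ↔ Y.d rfl z.1 + Hom.f φ (q + 1) z.2 = 0 ∧ X.d rfl z.2 = 0 := by
  rw [cone_d]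
  exact Prod.ext_iff.trans (and_congr Iff.rfl neg_eq_zero)

lemma cone_mem_coboundaries {φ : X ⟶ Y} {q : ℤ} {z : (cone φ).X (q + 1)} :
    z ∈ (cone φ).coboundaries (q + 1) ↔ ∃ (y : Y.X q) (x : X.X (q + 1)),
      Y.d rfl y + Hom.f φ (q + 1) x = z.1 ∧ -X.d rfl x = z.2 := by
  constructor
  · intro h
    obtain ⟨w, hw⟩ := (mem_coboundaries_iff (rfl : q + 1 = q + 1)).1 h
    exact ⟨w.1, w.2, Prod.ext_iff.1 hw⟩
  · rintro ⟨y, x, h₁, h₂⟩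
    exact (mem_coboundaries_iff rfl).2 ⟨(y, x), Prod.ext h₁ h₂⟩

lemma acyclic_cone {φ : X ⟶ Y} (hφ : quasiIso A φ) : (cone φ).Acyclic := by
  intro q z hz
  obtain ⟨q, rfl⟩ : ∃ p, q = p + 1 := ⟨q - 1, by lia⟩
  obtain ⟨h₁, h₂⟩ := cone_d_eq_zero.1 hz
  have hb : Hom.f φ _ z.2 ∈ Y.coboundaries _ := (mem_coboundaries_iff rfl).2
    ⟨-z.1, (map_neg _ _).trans (neg_eq_of_add_eq_zero_right h₁)⟩
  obtain ⟨x, hx⟩ := (mem_coboundaries_iff rfl).1 (((quasiIso_iff φ).1 hφ _).1 z.2 h₂ hb)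
  obtain ⟨x', hx', hb'⟩ := ((quasiIso_iff φ).1 hφ _).2 (z.1 + Hom.f φ _ x) (by
    rw [map_add, ← Hom.comm, hx, h₁])
  obtain ⟨y, hy⟩ := (mem_coboundaries_iff rfl).1 hb'
  refine cone_mem_coboundaries.2 ⟨-y, x' - x, ?_, ?_⟩
  · rw [map_neg, hy, map_sub]
    abel
  · rw [map_sub, hx', hx, zero_sub, neg_neg]

lemma shortExact_cone (φ : X ⟶ Y) : ShortExact (coneInl φ) (coneSnd φ) where
  injective _ _ _ h := congrArg Prod.fst h
  surjective _ x := ⟨(0, x), rfl⟩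
  comp_eq_zero := rfl
  exact _ x hx := ⟨x.1, Prod.ext rfl hx.symm⟩

lemma ShortExact.quasiIso_coneDesc {i : X ⟶ Y} {p : Y ⟶ Z} (h : ShortExact i p) :
    quasiIso A (coneDesc i p ((NullHomotopy.zero X Z).ofEq h.comp_eq_zero.symm)) := by
  -- The kernel of this morphism is the cone of `𝟙 X`.
  refine ShortExact.quasiIso_right (i := coneMap (𝟙 X) i (𝟙 X) i rfl) ?_
    (acyclic_cone (MorphismProperty.id_mem _ X))
  refine ⟨fun q x y hxy => ?_, fun q z => ?_, ?_, fun q x hx => ?_⟩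
  · obtain ⟨h₁, h₂⟩ := Prod.ext_iff.1 hxy
    exact Prod.ext (h.injective q h₁) h₂
  · obtain ⟨y, hy⟩ := h.surjective q z
    exact ⟨(y, 0), (add_zero _).trans hy⟩
  · ext q x
    exact (add_zero _).trans (h.comp_apply x.1)
  · obtain ⟨y, hy⟩ := h.exact q x.1 ((add_zero _).symm.trans hx)
    exact ⟨(y, x.2), Prod.ext hy rfl⟩

end cone

/-! ### Isomorphisms between suspensions -/

/-- Transport of degrees, as an equivalence. -/
def castEquiv (M : DGMod A) {q q' : ℤ} (h : q = q') : M.X q ≃+ M.X q' where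
  toFun := M.cast h
  invFun := M.cast h.symm
  left_inv x := by subst h; rfl
  right_inv x := by subst h; rfl
  map_add' := map_add _

/-- A DG isomorphism from degreewise isomorphisms. -/
def isoMk {M N : DGMod A} (e : ∀ q, M.X q ≃+ N.X q)
    (comm : ∀ {q q' : ℤ} (h : q + 1 = q') (x : M.X q), e q' (M.d h x) = N.d h (e q x))
    (map_smul : ∀ {p q n : ℤ} (h : p + q = n) (a : A.gr p) (x : M.X q),
      e n (M.smul h a x) = N.smul h a (e q x)) : M ≅ N where
  hom := ⟨fun q => (e q : M.X q →+ N.X q), comm, map_smul⟩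
  inv := ⟨fun q => ((e q).symm : N.X q →+ M.X q),
    fun {q q'} h x => (e q').injective (by simp [comm]),
    fun {p q n} h a x => (e n).injective (by simp [map_smul])⟩
  hom_inv_id := by ext q x; exact (e q).symm_apply_apply x
  inv_hom_id := by ext q x; exact (e q).apply_symm_apply x

/-- `Σ^j Σ^i M` is `Σ^(i+j) M`. -/
def shiftShiftIso (M : DGMod A) (i j s : ℤ) (h : j + i = s) :
    (M.shift i).shift j ≅ M.shift s :=
  isoMk (fun q => M.castEquiv (show q + j + i = q + s by lia))
    (fun {q q'} e (x : M.X (q + j + i)) => by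
      subst h
      change M.cast _ (j.negOnePow • i.negOnePow • M.d _ x) =
        (j + i).negOnePow • M.d _ (M.cast _ x)
      rw [map_units_smul, map_units_smul, cast_d, d_cast, smul_smul, Int.negOnePow_add])
    (fun {p q n} e a (x : M.X (q + j + i)) => by
      subst h
      change M.cast _ ((p * j).negOnePow • (p * i).negOnePow • M.smul _ a x) =
        (p * (j + i)).negOnePow • M.smul _ a (M.cast _ x)
      rw [map_units_smul, map_units_smul, cast_smul, smul_cast, smul_smul, mul_add,
        Int.negOnePow_add])

/-- `Σ^0 M` is `M`. -/
def shiftZeroIso (M : DGMod A) : M.shift 0 ≅ M :=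
  isoMk (fun q => M.castEquiv (add_zero q))
    (fun {q q'} e (x : M.X (q + 0)) => by
      change M.cast _ ((0 : ℤ).negOnePow • M.d _ x) = M.d _ (M.cast _ x)
      rw [map_units_smul, cast_d, d_cast, Int.negOnePow_zero, _root_.one_smul])
    (fun {p q n} e a (x : M.X (q + 0)) => by
      change M.cast _ ((p * 0).negOnePow • M.smul _ a x) = M.smul _ a (M.cast _ x)
      rw [map_units_smul, cast_smul, smul_cast, mul_zero, Int.negOnePow_zero, _root_.one_smul])

/-- `Σ Σ⁻¹ M` is `M`. -/
def unshiftIso (M : DGMod A) :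
    (shiftFun A 1).obj ((shiftFun A (-1)).obj M) ≅ M :=
  shiftShiftIso M (-1) 1 0 (by lia) ≪≫ shiftZeroIso M

lemma unshiftIso_hom_f (M : DGMod A) (q : ℤ) (x : M.X (q + 1 + -1)) :
    Hom.f (unshiftIso M).hom q x = M.cast (by lia) x := by
  change M.cast _ (M.cast _ x) = _
  generalize_proofs h₁ h₂ h₃
  revert h₁ h₂ h₃
  generalize q + 0 = t
  rintro rfl _ _
  rfl

lemma unshiftIso_naturality {M N : DGMod A} (φ : M ⟶ N) :
    (shiftFun A 1).map ((shiftFun A (-1)).map φ) ≫ (unshiftIso N).hom =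
      (unshiftIso M).hom ≫ φ := by
  ext q x
  refine (unshiftIso_hom_f N q _).trans ?_
  refine Eq.trans ?_ (congrArg (Hom.f φ q) (unshiftIso_hom_f M q x)).symm
  exact (Hom.f_cast φ _ _).symm


section lifting

variable {X Y Z : DGMod A}

/-- A null homotopy into `Σ Y`, as a family of maps of degree `0` into `Y`. -/
def NullHomotopy.unshift {φ : Z ⟶ (shiftFun A 1).obj Y} (s : NullHomotopy φ) (q : ℤ) :
    Z.X q →+ Y.X q :=
  (Y.cast (show q - 1 + 1 = q by lia)).comp (s.s (show q - 1 + 1 = q by lia))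

lemma NullHomotopy.unshift_apply {φ : Z ⟶ (shiftFun A 1).obj Y} (s : NullHomotopy φ)
    {q : ℤ} (z : Z.X (q + 1)) : s.unshift (q + 1) z = s.s (rfl : q + 1 = q + 1) z := by
  have : ∀ (t : ℤ) (h : t + 1 = q + 1), Y.cast h (s.s h z) = s.s (rfl : q + 1 = q + 1) z := by
    intro t h
    obtain rfl : t = q := by lia
    rfl
  exact this _ _

lemma NullHomotopy.unshift_smul {φ : Z ⟶ (shiftFun A 1).obj Y} (s : NullHomotopy φ) {p q n : ℤ}
    (h : p + q = n) (a : A.gr p) (z : Z.X q) :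
    s.unshift n (Z.smul h a z) = Y.smul h a (s.unshift q z) := by
  obtain ⟨q, rfl⟩ : ∃ r, q = r + 1 := ⟨q - 1, by lia⟩
  obtain ⟨n, rfl⟩ : ∃ r, n = r + 1 := ⟨n - 1, by lia⟩
  rw [unshift_apply, unshift_apply, s.map_smul rfl rfl h (show p + q = n by lia)]
  change p.negOnePow • (p * 1).negOnePow • Y.smul _ a _ = _
  simp [smul_smul]

lemma NullHomotopy.unshift_comm {φ : Z ⟶ (shiftFun A 1).obj Y} (s : NullHomotopy φ) {q : ℤ}
    (z : Z.X q) : Hom.f φ q z =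
      s.unshift (q + 1) (Z.d rfl z) - Y.d rfl (s.unshift q z) := by
  obtain ⟨q, rfl⟩ : ∃ r, q = r + 1 := ⟨q - 1, by lia⟩
  rw [unshift_apply, unshift_apply, s.comm rfl rfl]
  change (1 : ℤ).negOnePow • Y.d _ _ + _ = _
  rw [Int.negOnePow_one, Units.neg_smul, _root_.one_smul]
  exact neg_add_eq_sub _ _

/-- The morphism into a cone given by a morphism to `Σ X` and a null homotopy. -/
def coneLift (φ : X ⟶ Y) (g : Z ⟶ (shiftFun A 1).obj X)
    (s : NullHomotopy (g ≫ (shiftFun A 1).map φ)) : Z ⟶ cone φ where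
  f q := (s.unshift q).prod (Hom.f g q)
  comm {q q'} h z := by
    subst h
    refine Prod.ext ?_ ?_
    · have := s.unshift_comm z
      change s.unshift _ (Z.d rfl z) = Y.d rfl (s.unshift q z) + Hom.f φ _ (Hom.f g q z)
      rw [show Hom.f φ (q + 1) (Hom.f g q z) = _ from this]
      abel
    · refine (Hom.comm g rfl z).trans ?_
      change (1 : ℤ).negOnePow • X.d _ (Hom.f g q z) = -X.d _ (Hom.f g q z)
      simp
  map_smul {p q n} h a z := by
    refine Prod.ext (s.unshift_smul h a z) ((Hom.map_smul g h a z).trans ?_)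
    change (p * 1).negOnePow • X.smul _ a (Hom.f g q z) = p.negOnePow • X.smul _ a (Hom.f g q z)
    simp

lemma coneLift_coneSnd (φ : X ⟶ Y) (g : Z ⟶ (shiftFun A 1).obj X)
    (s : NullHomotopy (g ≫ (shiftFun A 1).map φ)) : coneLift φ g s ≫ coneSnd φ = g := rfl

lemma exists_lift_of_nullHomotopy (φ : X ⟶ Y) (w : Z ⟶ Y) (s : NullHomotopy (w ≫ coneInl φ)) :
    ∃ v : Z ⟶ X, Nonempty (NullHomotopy (w - v ≫ φ)) := by
  let t : NullHomotopy (0 : Z ⟶ (shiftFun A 1).obj X) :=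
    (s.compRight (coneSnd φ)).ofEq (by ext q x; rfl)
  refine ⟨⟨fun q => t.unshift q, fun {q q'} h z => ?_, fun h a z => t.unshift_smul h a z⟩,
    ⟨⟨fun {q q'} h => (AddMonoidHom.fst (Y.X q') (X.X (q' + 1))).comp (s.s h), ?_, ?_⟩⟩⟩
  · subst h
    exact sub_eq_zero.1 ((t.unshift_comm z).symm.trans rfl)
  · intro q q' q'' h h' z
    subst h h'
    have h₁ := congrArg Prod.fst (s.comm rfl rfl z)
    have h₂ : t.unshift (q' + 1) z = (s.s (rfl : q' + 1 = q' + 1) z).2 := t.unshift_apply z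
    change Hom.f w _ z = Y.d rfl (s.s rfl z).1 + Hom.f φ _ (s.s rfl z).2 +
      (s.s rfl (Z.d rfl z)).1 at h₁
    change Hom.f w _ z + -(Hom.f φ _ (t.unshift _ z)) = Y.d rfl (s.s rfl z).1 +
      (s.s rfl (Z.d rfl z)).1
    rw [h₁, h₂]
    abel
  · intro p q q' n n' hq hn h e a z
    exact congrArg Prod.fst (s.map_smul hq hn h e a z)

end lifting

/-! ### Homotopy pushouts -/

section pushout

variable {X Y Z : DGMod A}

/-- The morphism `(φ, -α) : X ⟶ Y ⊕ Z`, whose cone is the homotopy pushout of `φ` and `α`. -/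
def pushoutMap (φ : X ⟶ Y) (α : X ⟶ Z) : X ⟶ (prodBicone Y Z).pt :=
  φ ≫ (prodBicone Y Z).inl - α ≫ (prodBicone Y Z).inr

lemma pushoutMap_fst (φ : X ⟶ Y) (α : X ⟶ Z) :
    pushoutMap φ α ≫ (prodBicone Y Z).fst = φ := by
  rw [pushoutMap, Preadditive.sub_comp, Category.assoc, Category.assoc, BinaryBicone.inl_fst,
    BinaryBicone.inr_fst]
  simp

lemma pushoutMap_snd (φ : X ⟶ Y) (α : X ⟶ Z) :
    pushoutMap φ α ≫ (prodBicone Y Z).snd = -α := by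
  rw [pushoutMap, Preadditive.sub_comp, Category.assoc, Category.assoc, BinaryBicone.inl_snd,
    BinaryBicone.inr_snd]
  simp

lemma shortExact_pushout (φ : X ⟶ Y) (α : X ⟶ Z) :
    ShortExact ((prodBicone Y Z).inr ≫ coneInl (pushoutMap φ α))
      (coneMap (pushoutMap φ α) φ (𝟙 X) (prodBicone Y Z).fst
        ((pushoutMap_fst φ α).trans (Category.id_comp φ).symm)) where
  injective q x y h := congrArg (fun t : (Y.X q × Z.X q) × X.X (q + 1) => t.1.2) h
  surjective q x := ⟨(((x.1, 0) : Y.X q × Z.X q), x.2), rfl⟩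
  comp_eq_zero := by
    ext q x
    rfl
  exact q z h := by
    obtain ⟨⟨y, z⟩, x⟩ : (Y.X q × Z.X q) × X.X (q + 1) := z
    have h₁ : y = 0 := congrArg Prod.fst h
    have h₂ : x = 0 := congrArg Prod.snd h
    subst h₁ h₂
    exact ⟨z, rfl⟩

end pushout

/-! ### Ore conditions up to homotopy -/

lemma exists_quasiIso_comp_null_of_acyclic {Z C : DGMod A} (g : Z ⟶ C) (hC : C.Acyclic) :
    ∃ (Z' : DGMod A) (t : Z' ⟶ Z), quasiIso A t ∧ Nonempty (NullHomotopy (t ≫ g)) := by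
  refine ⟨_, coneSnd ((shiftFun A (-1)).map g) ≫ (unshiftIso Z).hom,
    (MorphismProperty.cancel_right_of_respectsIso _ _ _).2
      ((shortExact_cone _).quasiIso_right (hC.shift (-1))),
    ⟨((nullHomotopyConeSnd _).compRight (unshiftIso C).hom).ofEq ?_⟩⟩
  rw [Category.assoc, Category.assoc, unshiftIso_naturality]

lemma exists_right_ore {X Y Y' : DGMod A} (f : X ⟶ Y) (s : Y' ⟶ Y) (hs : quasiIso A s) :
    ∃ (X' : DGMod A) (t : X' ⟶ X) (v : X' ⟶ Y'), quasiIso A t ∧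
      Nonempty (NullHomotopy (t ≫ f - v ≫ s)) := by
  obtain ⟨X', t, ht, ⟨h⟩⟩ := exists_quasiIso_comp_null_of_acyclic (f ≫ coneInl s) (acyclic_cone hs)
  obtain ⟨v, hv⟩ := exists_lift_of_nullHomotopy s (t ≫ f) (h.ofEq (Category.assoc _ _ _).symm)
  exact ⟨X', t, v, ht, hv⟩

lemma exists_right_cancel {X Y Y' : DGMod A} (f : X ⟶ Y) (t : Y ⟶ Y') (ht : quasiIso A t)
    (h : NullHomotopy (f ≫ t)) :
    ∃ (X' : DGMod A) (s : X' ⟶ X), quasiIso A s ∧ Nonempty (NullHomotopy (s ≫ f)) := by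
  have w : (f ≫ t) ≫ (unshiftIso Y').inv =
      (f ≫ (unshiftIso Y).inv) ≫ (shiftFun A 1).map ((shiftFun A (-1)).map t) := by
    rw [← cancel_mono (unshiftIso Y').hom]
    simp [unshiftIso_naturality]
  have hc := acyclic_cone (quasiIso_shiftFun (-1) t ht)
  obtain ⟨X', s, hs, ⟨h'⟩⟩ := exists_quasiIso_comp_null_of_acyclic
    (coneLift _ _ ((h.compRight (unshiftIso Y').inv).ofEq w)) hc
  refine ⟨X', s, hs, ⟨(h'.compRight (coneSnd _ ≫ (unshiftIso Y).hom)).ofEq ?_⟩⟩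
  rw [Category.assoc, ← Category.assoc (coneLift _ _ _), coneLift_coneSnd]
  simp

lemma exists_left_cancel {X' X Y : DGMod A} (s : X' ⟶ X) (f : X ⟶ Y) (hs : quasiIso A s)
    (h : NullHomotopy (s ≫ f)) :
    ∃ (Y' : DGMod A) (t : Y ⟶ Y'), quasiIso A t ∧ Nonempty (NullHomotopy (f ≫ t)) := by
  refine ⟨_, coneInl (coneDesc s f h),
    (shortExact_cone _).quasiIso_left ((acyclic_cone hs).shift 1),
    ⟨((nullHomotopyConeInl (coneDesc s f h)).compLeft (coneInl s)).ofEq ?_⟩⟩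
  rw [← Category.assoc, coneInl_coneDesc]

lemma exists_left_ore {X X' Y : DGMod A} (f : X ⟶ Y) (s : X ⟶ X') (hs : quasiIso A s) :
    ∃ (Y' : DGMod A) (t : Y ⟶ Y') (v : X' ⟶ Y'), quasiIso A t ∧
      Nonempty (NullHomotopy (f ≫ t - s ≫ v)) := by
  refine ⟨_, _, (prodBicone X' Y).inl ≫ coneInl (pushoutMap s f),
    (shortExact_pushout s f).quasiIso_left (acyclic_cone hs),
    ⟨(nullHomotopyConeInl (pushoutMap s f)).neg.ofEq ?_⟩⟩
  refine (congrArg Neg.neg (Preadditive.sub_comp _ _ _)).trans ((neg_sub _ _).trans ?_)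
  simp only [Category.assoc]

/-! ### The homotopy category -/

/-- The homotopy relation on DG morphisms. -/
def homotopic (A : DGAlg k) : HomRel (DGMod A) := fun _ _ φ ψ => Nonempty (NullHomotopy (φ - ψ))

instance : Congruence (homotopic A) where
  equivalence :=
    { refl := fun φ => ⟨(NullHomotopy.zero _ _).ofEq (sub_self φ).symm⟩
      symm := fun ⟨h⟩ => ⟨h.neg.ofEq (neg_sub _ _)⟩
      trans := fun ⟨h⟩ ⟨h'⟩ => ⟨(h.add h').ofEq (sub_add_sub_cancel _ _ _)⟩ }
  comp_left f _ _ := fun ⟨h⟩ => ⟨(h.compLeft f).ofEq (Preadditive.comp_sub _ _ _)⟩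
  comp_right g := fun ⟨h⟩ => ⟨(h.compRight g).ofEq (Preadditive.sub_comp _ _ _)⟩

/-- The homotopy category of DG modules. -/
abbrev HoCat (A : DGAlg k) := CategoryTheory.Quotient (homotopic A)

/-- The functor from DG modules to the homotopy category. -/
abbrev toHoCat (A : DGAlg k) : DGMod A ⥤ HoCat A := CategoryTheory.Quotient.functor (homotopic A)

/-- The quasi-isomorphisms of the homotopy category. -/
def hoQuasiIso (A : DGAlg k) : MorphismProperty (HoCat A) := fun X Y f =>
  ∃ φ : X.as ⟶ Y.as, quasiIso A φ ∧ (toHoCat A).map φ = f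

instance : (hoQuasiIso A).IsMultiplicative where
  id_mem X := ⟨𝟙 _, MorphismProperty.id_mem _ _, (toHoCat A).map_id _⟩
  comp_mem := by
    rintro X Y Z _ _ ⟨φ, hφ, rfl⟩ ⟨ψ, hψ, rfl⟩
    exact ⟨φ ≫ ψ, MorphismProperty.comp_mem _ _ _ hφ hψ, (toHoCat A).map_comp _ _⟩

lemma toHoCat_map_eq_iff {X Y : DGMod A} (f g : X ⟶ Y) :
    (toHoCat A).map f = (toHoCat A).map g ↔ Nonempty (NullHomotopy (f - g)) :=
  CategoryTheory.Quotient.functor_map_eq_iff _ _ _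

instance : (hoQuasiIso A).HasLeftCalculusOfFractions where
  exists_leftFraction := by
    rintro ⟨X⟩ ⟨Y⟩ ⟨s, ⟨s, hs, rfl⟩, f⟩
    obtain ⟨f, rfl⟩ := (toHoCat A).map_surjective f
    obtain ⟨Y', t, v, ht, h⟩ := exists_left_ore f s hs
    refine ⟨⟨(toHoCat A).map v, (toHoCat A).map t, ⟨t, ht, rfl⟩⟩, ?_⟩
    exact (toHoCat_map_eq_iff (f ≫ t) (s ≫ v)).2 h
  ext := by
    rintro ⟨X'⟩ ⟨X⟩ ⟨Y⟩ f₁ f₂ s ⟨s, hs, rfl⟩ h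
    obtain ⟨f₁, rfl⟩ := (toHoCat A).map_surjective f₁
    obtain ⟨f₂, rfl⟩ := (toHoCat A).map_surjective f₂
    obtain ⟨h⟩ := (toHoCat_map_eq_iff (s ≫ f₁) (s ≫ f₂)).1 h
    obtain ⟨Y', t, ht, ⟨h'⟩⟩ := exists_left_cancel s (f₁ - f₂) hs
      (h.ofEq (Preadditive.comp_sub _ _ _).symm)
    refine ⟨⟨Y'⟩, (toHoCat A).map t, ⟨t, ht, rfl⟩, ?_⟩
    exact (toHoCat_map_eq_iff (f₁ ≫ t) (f₂ ≫ t)).2 ⟨h'.ofEq (Preadditive.sub_comp _ _ _)⟩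

end DGMod

namespace DerivedCat

open DGMod

variable {A : DGAlg k}

lemma isIso_Q_map {M N : DGMod A} {φ : M ⟶ N} (hφ : quasiIso A φ) : IsIso ((Q A).map φ) :=
  Localization.inverts (Q A) (quasiIso A) φ hφ

lemma isZero_Q_obj {M : DGMod A} (hM : M.Acyclic) : IsZero ((Q A).obj M) := by
  have := isIso_Q_map (quasiIso_zero_of_acyclic hM)
  rw [IsZero.iff_id_eq_zero, ← cancel_mono ((Q A).map (0 : M ⟶ zero A))]
  simp

lemma Q_map_eq_zero {M N : DGMod A} {φ : M ⟶ N} (s : NullHomotopy φ) : (Q A).map φ = 0 := by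
  rw [← coneInl_coneDesc (𝟙 M) φ (s.ofEq (Category.id_comp φ).symm), Functor.map_comp]
  exact ((isZero_Q_obj (acyclic_cone (MorphismProperty.id_mem _ _))).eq_of_tgt _ 0 =≫ _).trans
    zero_comp

/-- The functor from the homotopy category to the derived category. -/
def Qh (A : DGAlg k) : HoCat A ⥤ DerivedCat A :=
  CategoryTheory.Quotient.lift (homotopic A) (Q A) (fun _ _ f g ⟨h⟩ => by
    rw [← sub_eq_zero, ← Functor.map_sub]
    exact Q_map_eq_zero h)

lemma toHoCat_comp_Qh : toHoCat A ⋙ Qh A = Q A := CategoryTheory.Quotient.lift_spec _ _ _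

lemma hoQuasiIso_isInvertedBy : (hoQuasiIso A).IsInvertedBy (Qh A) := by
  rintro X Y _ ⟨φ, hφ, rfl⟩
  exact isIso_Q_map hφ

/-- The derived category is the localization of the homotopy category. -/
def strictUniversalPropertyQh (E : Type*) [Category* E] :
    Localization.StrictUniversalPropertyFixedTarget (Qh A) (hoQuasiIso A) E where
  inverts := hoQuasiIso_isInvertedBy
  lift F hF := Localization.Construction.lift (toHoCat A ⋙ F)
    (fun _ _ φ hφ => hF _ ⟨φ, hφ, rfl⟩)
  fac F hF := by
    have h : ∀ (x y : DGMod A) (f₁ f₂ : x ⟶ y), homotopic A f₁ f₂ →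
        (toHoCat A ⋙ F).map f₁ = (toHoCat A ⋙ F).map f₂ := fun _ _ f₁ f₂ h =>
      congrArg F.map (CategoryTheory.Quotient.sound _ h)
    refine Eq.trans (CategoryTheory.Quotient.lift_unique (homotopic A) (toHoCat A ⋙ F) h _ ?_)
      (CategoryTheory.Quotient.lift_unique (homotopic A) (toHoCat A ⋙ F) h F rfl).symm
    rw [← Functor.assoc, toHoCat_comp_Qh]
    exact Localization.Construction.fac _ _
  uniq F₁ F₂ h := by
    refine Localization.Construction.uniq _ _ ?_
    have := congrArg (toHoCat A ⋙ ·) h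
    rwa [← Functor.assoc, ← Functor.assoc, toHoCat_comp_Qh] at this

instance : (Qh A).IsLocalization (hoQuasiIso A) :=
  Functor.IsLocalization.mk' _ _ (strictUniversalPropertyQh _) (strictUniversalPropertyQh _)

/-! ### Morphisms in the derived category as fractions -/

lemma exists_left_fraction {X Y : DGMod A} (f : (Q A).obj X ⟶ (Q A).obj Y) :
    ∃ (Y' : DGMod A) (g : X ⟶ Y') (s : Y ⟶ Y'), quasiIso A s ∧
      f ≫ (Q A).map s = (Q A).map g := by
  obtain ⟨⟨g, s, hs⟩, h⟩ := Localization.exists_leftFraction (Qh A) (hoQuasiIso A)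
    (X := ⟨X⟩) (Y := ⟨Y⟩) f
  obtain ⟨s, hs, rfl⟩ := hs
  obtain ⟨g, rfl⟩ := (toHoCat A).map_surjective g
  refine ⟨_, g, s, hs, ?_⟩
  have := MorphismProperty.LeftFraction.map_comp_map_s
    ⟨(toHoCat A).map g, (toHoCat A).map s, ⟨s, hs, rfl⟩⟩ (Qh A)
    (Localization.inverts (Qh A) (hoQuasiIso A))
  rw [← h] at this
  exact this

lemma exists_right_fraction {X Y : DGMod A} (f : (Q A).obj X ⟶ (Q A).obj Y) :
    ∃ (X' : DGMod A) (s : X' ⟶ X) (g : X' ⟶ Y), quasiIso A s ∧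
      (Q A).map s ≫ f = (Q A).map g := by
  obtain ⟨Y', g, s, hs, hf⟩ := exists_left_fraction f
  obtain ⟨X', t, v, ht, ⟨h⟩⟩ := exists_right_ore g s hs
  have := isIso_Q_map hs
  have hv : (Q A).map (t ≫ g) = (Q A).map (v ≫ s) := by
    rw [← sub_eq_zero, ← Functor.map_sub]
    exact Q_map_eq_zero h
  refine ⟨X', t, v, ht, ?_⟩
  rw [← cancel_mono ((Q A).map s), Category.assoc, hf, ← Functor.map_comp, hv, Functor.map_comp]

lemma exists_postcomp_null {X Y : DGMod A} {f : X ⟶ Y} (hf : (Q A).map f = 0) :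
    ∃ (Y' : DGMod A) (s : Y ⟶ Y'), quasiIso A s ∧ Nonempty (NullHomotopy (f ≫ s)) := by
  obtain ⟨⟨Y'⟩, s, ⟨s, hs, rfl⟩, h⟩ := (MorphismProperty.map_eq_iff_postcomp (Qh A) (hoQuasiIso A)
    ((toHoCat A).map f) ((toHoCat A).map 0)).1 (hf.trans (Functor.map_zero (Q A) X Y).symm)
  obtain ⟨h⟩ := (toHoCat_map_eq_iff (f ≫ s) (0 ≫ s)).1 h
  exact ⟨Y', s, hs, ⟨h.ofEq (by simp)⟩⟩

lemma exists_precomp_null {X Y : DGMod A} {f : X ⟶ Y} (hf : (Q A).map f = 0) :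
    ∃ (X' : DGMod A) (s : X' ⟶ X), quasiIso A s ∧ Nonempty (NullHomotopy (s ≫ f)) := by
  obtain ⟨Y', s, hs, ⟨h⟩⟩ := exists_postcomp_null hf
  exact exists_right_cancel f s hs h

lemma Q_obj_surjective (X : DerivedCat A) : ∃ X' : DGMod A, (Q A).obj X' = X :=
  (Localization.Construction.objEquiv (quasiIso A)).surjective X

lemma exists_arrow_iso {X Y : DerivedCat A} (f : X ⟶ Y) :
    ∃ (X' Y' : DGMod A) (φ : X' ⟶ Y') (a : X ≅ (Q A).obj X') (b : Y ≅ (Q A).obj Y'),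
      f ≫ b.hom = a.hom ≫ (Q A).map φ := by
  obtain ⟨X, rfl⟩ := Q_obj_surjective X
  obtain ⟨Y, rfl⟩ := Q_obj_surjective Y
  obtain ⟨Y', g, s, hs, h⟩ := exists_left_fraction f
  have := isIso_Q_map hs
  exact ⟨X, Y', g, Iso.refl _, asIso ((Q A).map s), by simp [h]⟩

/-! ### Exact triangles -/

lemma exists_cone_desc {X Y : DGMod A} (φ : X ⟶ Y) {Z : DerivedCat A} (x : (Q A).obj Y ⟶ Z)
    (hx : (Q A).map φ ≫ x = 0) : ∃ y, (Q A).map (coneInl φ) ≫ y = x := by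
  obtain ⟨Z, rfl⟩ := Q_obj_surjective Z
  obtain ⟨Z', g, s, hs, h⟩ := exists_left_fraction x
  have hg : (Q A).map (φ ≫ g) = 0 := by
    rw [Functor.map_comp, ← h, ← Category.assoc, hx, zero_comp]
  obtain ⟨Z'', t, ht, ⟨n⟩⟩ := exists_postcomp_null hg
  have := isIso_Q_map (MorphismProperty.comp_mem _ _ _ hs ht)
  refine ⟨(Q A).map (coneDesc φ (g ≫ t) (n.ofEq (Category.assoc _ _ _))) ≫
    inv ((Q A).map (s ≫ t)), ?_⟩
  rw [← Category.assoc, ← Functor.map_comp, coneInl_coneDesc, IsIso.comp_inv_eq, Functor.map_comp,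
    Functor.map_comp, ← Category.assoc, h]

lemma exists_cone_lift {X Y : DGMod A} (φ : X ⟶ Y) {Z : DerivedCat A} (x : Z ⟶ (Q A).obj Y)
    (hx : x ≫ (Q A).map (coneInl φ) = 0) : ∃ y, y ≫ (Q A).map φ = x := by
  obtain ⟨Z, rfl⟩ := Q_obj_surjective Z
  obtain ⟨Z', s, g, hs, h⟩ := exists_right_fraction x
  have hg : (Q A).map (g ≫ coneInl φ) = 0 := by
    rw [Functor.map_comp, ← h, Category.assoc, hx, comp_zero]
  obtain ⟨Z'', t, ht, ⟨n⟩⟩ := exists_precomp_null hg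
  have := isIso_Q_map (MorphismProperty.comp_mem _ _ _ ht hs)
  obtain ⟨v, ⟨m⟩⟩ := exists_lift_of_nullHomotopy φ (t ≫ g) (n.ofEq (Category.assoc _ _ _).symm)
  refine ⟨inv ((Q A).map (t ≫ s)) ≫ (Q A).map v, ?_⟩
  rw [Category.assoc, IsIso.inv_comp_eq, ← Functor.map_comp, Functor.map_comp (Q A) t s,
    Category.assoc, h, ← Functor.map_comp, eq_comm, ← sub_eq_zero, ← Functor.map_sub]
  exact Q_map_eq_zero m

lemma map_comp_coneInl {X Y : DGMod A} (φ : X ⟶ Y) :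
    (Q A).map φ ≫ (Q A).map (coneInl φ) = 0 := by
  rw [← Functor.map_comp]
  exact Q_map_eq_zero (nullHomotopyConeInl φ)

section triangle

variable {L M N : DerivedCat A} {f : L ⟶ M} {g : M ⟶ N} {h : N ⟶ (shift A 1).obj L}

lemma IsExactTriangle.comp_eq_zero (T : IsExactTriangle f g h) : f ≫ g = 0 := by
  obtain ⟨X, Y, φ, a, b, c, h₁, h₂, -⟩ := T
  rw [← cancel_mono c.hom, Category.assoc, h₂, ← Category.assoc, h₁, Category.assoc,
    map_comp_coneInl, comp_zero, zero_comp]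

lemma IsExactTriangle.exists_desc (T : IsExactTriangle f g h) {Z : DerivedCat A} (x : M ⟶ Z)
    (hx : f ≫ x = 0) : ∃ y, g ≫ y = x := by
  obtain ⟨X, Y, φ, a, b, c, h₁, h₂, -⟩ := T
  obtain ⟨y, hy⟩ := exists_cone_desc φ (b.inv ≫ x) (by
    rw [← cancel_epi a.hom, ← Category.assoc, ← h₁, Category.assoc, Iso.hom_inv_id_assoc, hx,
      comp_zero])
  exact ⟨c.hom ≫ y, by rw [← Category.assoc, h₂, Category.assoc, hy, Iso.hom_inv_id_assoc]⟩

lemma IsExactTriangle.exists_lift (T : IsExactTriangle f g h) {Z : DerivedCat A} (x : Z ⟶ M)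
    (hx : x ≫ g = 0) : ∃ y, y ≫ f = x := by
  obtain ⟨X, Y, φ, a, b, c, h₁, h₂, -⟩ := T
  obtain ⟨y, hy⟩ := exists_cone_lift φ (x ≫ b.hom) (by
    rw [Category.assoc, ← h₂, ← Category.assoc, hx, zero_comp])
  refine ⟨y ≫ a.inv, ?_⟩
  rw [← cancel_mono b.hom, Category.assoc, Category.assoc, h₁, Iso.inv_hom_id_assoc, hy]

lemma exists_isExactTriangle_of_iso {X Y : DGMod A} (φ : X ⟶ Y) (a : L ≅ (Q A).obj X)
    (b : M ≅ (Q A).obj Y) (c : N ≅ (Q A).obj (cone φ)) (h₁ : f ≫ b.hom = a.hom ≫ (Q A).map φ)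
    (h₂ : g ≫ c.hom = b.hom ≫ (Q A).map (coneInl φ)) : ∃ h, IsExactTriangle f g h :=
  ⟨c.hom ≫ (Q A).map (coneSnd φ) ≫ (shiftIso A 1).inv.app X ≫ (shift A 1).map a.inv,
    X, Y, φ, a, b, c, h₁, h₂, by
      simp only [Category.assoc]
      rw [← Functor.map_comp_assoc, Iso.inv_hom_id, CategoryTheory.Functor.map_id, Category.id_comp,
        Iso.inv_hom_id_app]
      exact congrArg _ (Category.comp_id _)⟩

lemma IsExactTriangle.of_iso (T : IsExactTriangle f g h) {L' M' N' : DerivedCat A}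
    {f' : L' ⟶ M'} {g' : M' ⟶ N'} (a : L' ≅ L) (b : M' ≅ M) (c : N' ≅ N)
    (h₁ : f' ≫ b.hom = a.hom ≫ f) (h₂ : g' ≫ c.hom = b.hom ≫ g) :
    ∃ h', IsExactTriangle f' g' h' := by
  obtain ⟨X, Y, φ, a', b', c', h₁', h₂', -⟩ := T
  exact exists_isExactTriangle_of_iso φ (a ≪≫ a') (b ≪≫ b') (c ≪≫ c')
    (by simp [reassoc_of% h₁, h₁']) (by simp [reassoc_of% h₂, h₂'])

lemma exists_isExactTriangle_of_shortExact {L M N : DGMod A} {i : L ⟶ M} {p : M ⟶ N}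
    (h : ShortExact i p) : ∃ t, IsExactTriangle ((Q A).map i) ((Q A).map p) t := by
  have := isIso_Q_map h.quasiIso_coneDesc
  refine exists_isExactTriangle_of_iso i (Iso.refl _) (Iso.refl _)
    (asIso ((Q A).map (coneDesc i p ((NullHomotopy.zero L N).ofEq h.comp_eq_zero.symm)))).symm
    (by simp) ?_
  rw [Iso.symm_hom, asIso_inv, IsIso.comp_inv_eq, Iso.refl_hom, Category.id_comp,
    ← Functor.map_comp, coneInl_coneDesc]

lemma exists_isExactTriangle (f : L ⟶ M) :
    ∃ (N : DerivedCat A) (g : M ⟶ N) (h : N ⟶ (shift A 1).obj L), IsExactTriangle f g h := by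
  obtain ⟨X, Y, φ, a, b, hf⟩ := exists_arrow_iso f
  exact ⟨_, b.hom ≫ (Q A).map (coneInl φ),
    exists_isExactTriangle_of_iso φ a b (Iso.refl _) hf (Category.comp_id _)⟩

lemma IsExactTriangle.rotate (T : IsExactTriangle f g h) : ∃ h', IsExactTriangle g h h' := by
  obtain ⟨X, Y, φ, a, b, c, -, h₂, h₃⟩ := T
  obtain ⟨t, ht⟩ := exists_isExactTriangle_of_shortExact (shortExact_cone φ)
  exact ht.of_iso b c ((shift A 1).mapIso a ≪≫ (shiftIso A 1).app X) h₂ h₃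

lemma IsExactTriangle.comp_shift_map_eq_zero (T : IsExactTriangle f g h) :
    h ≫ (shift A 1).map f = 0 := by
  obtain ⟨X, Y, φ, a, b, c, h₁, -, h₃⟩ := T
  have hb : (shift A 1).map f ≫ (shift A 1).map b.hom ≫ (shiftIso A 1).hom.app Y =
      (shift A 1).map a.hom ≫ (shiftIso A 1).hom.app X ≫ (Q A).map ((shiftFun A 1).map φ) := by
    rw [← Functor.map_comp_assoc, h₁, Functor.map_comp_assoc]
    exact congrArg _ ((shiftIso A 1).hom.naturality φ)
  rw [← cancel_mono ((shift A 1).map b.hom ≫ (shiftIso A 1).hom.app Y), Category.assoc, hb,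
    reassoc_of% h₃, ← Functor.map_comp, Q_map_eq_zero (nullHomotopyConeSnd φ), comp_zero, zero_comp]

lemma exists_fibre {X T : DerivedCat A} (u : X ⟶ T) :
    ∃ (F : DerivedCat A) (i : (shift A (-1)).obj T ⟶ F) (j : F ⟶ X)
      (h : X ⟶ (shift A 1).obj ((shift A (-1)).obj T)), IsExactTriangle i j h ∧ j ≫ u = 0 := by
  obtain ⟨X₀, T₀, φ, a, b, hu⟩ := exists_arrow_iso u
  let ψ := (shiftFun A (-1)).map φ
  obtain ⟨t, ht⟩ := exists_isExactTriangle_of_shortExact (shortExact_cone ψ)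
  obtain ⟨h, hT⟩ := ht.of_iso ((shift A (-1)).mapIso b ≪≫ (shiftIso A (-1)).app T₀) (Iso.refl _)
    (a ≪≫ ((Q A).mapIso (unshiftIso X₀)).symm)
    (f' := (shift A (-1)).map b.hom ≫ (shiftIso A (-1)).hom.app T₀ ≫ (Q A).map (coneInl ψ))
    (g' := (Q A).map (coneSnd ψ) ≫ (Q A).map (unshiftIso X₀).hom ≫ a.inv) (by simp) (by simp)
  refine ⟨_, _, _, h, hT, ?_⟩
  rw [← cancel_mono b.hom, Category.assoc, Category.assoc, Category.assoc, hu,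
    Iso.inv_hom_id_assoc, ← Functor.map_comp, ← unshiftIso_naturality, ← Functor.map_comp,
    ← Category.assoc, Functor.map_comp, Q_map_eq_zero (nullHomotopyConeSnd ψ), zero_comp, zero_comp]

lemma exists_pushout {X' X T G : DerivedCat A} {j : X' ⟶ X} {u : X ⟶ T}
    {h : T ⟶ (shift A 1).obj X'} (H : IsExactTriangle j u h) (a : X' ⟶ G) :
    ∃ (P : DerivedCat A) (i₁ : X ⟶ P) (i₂ : G ⟶ P) (p : P ⟶ T),
      (∃ t, IsExactTriangle i₂ p t) ∧ ∀ (Z : DerivedCat A) (c : X ⟶ Z) (e : G ⟶ Z),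
        j ≫ c = a ≫ e → ∃ y : P ⟶ Z, i₁ ≫ y = c ∧ i₂ ≫ y = e := by
  obtain ⟨X₁, X₀, φ, α, β, γ, h₁, -, -⟩ := H
  obtain ⟨G, rfl⟩ := Q_obj_surjective G
  obtain ⟨G₁, g, s, hs, hg⟩ := exists_left_fraction (α.inv ≫ a)
  have := isIso_Q_map hs
  obtain ⟨t, ht⟩ := exists_isExactTriangle_of_shortExact (shortExact_pushout φ g)
  refine ⟨(Q A).obj (cone (pushoutMap φ g)),
    β.hom ≫ (Q A).map ((prodBicone X₀ G₁).inl ≫ coneInl _),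
    (Q A).map s ≫ (Q A).map ((prodBicone X₀ G₁).inr ≫ coneInl _), (Q A).map
      (coneMap (pushoutMap φ g) φ (𝟙 X₁) (prodBicone X₀ G₁).fst
        ((pushoutMap_fst φ g).trans (Category.id_comp φ).symm)) ≫ γ.inv,
    ht.of_iso (asIso ((Q A).map s)) (Iso.refl _) γ (by simp) (by simp), fun Z c e hce => ?_⟩
  have hφ : (Q A).map φ ≫ β.inv ≫ c = (Q A).map g ≫ inv ((Q A).map s) ≫ e := by
    rw [← cancel_epi α.hom, ← Category.assoc, ← h₁, ← hg]
    simpa using hce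
  obtain ⟨y, hy⟩ := exists_cone_desc (pushoutMap φ g)
    ((Q A).map (prodBicone X₀ G₁).fst ≫ β.inv ≫ c +
      (Q A).map (prodBicone X₀ G₁).snd ≫ inv ((Q A).map s) ≫ e) (by
    rw [Preadditive.comp_add, ← Functor.map_comp_assoc, ← Functor.map_comp_assoc, pushoutMap_fst,
      pushoutMap_snd, hφ, Functor.map_neg, Preadditive.neg_comp, add_neg_cancel])
  refine ⟨y, ?_, ?_⟩
  · rw [Category.assoc, Functor.map_comp, Category.assoc, hy, Preadditive.comp_add,
      ← Functor.map_comp_assoc, ← Functor.map_comp_assoc, BinaryBicone.inl_fst,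
      BinaryBicone.inl_snd]
    simp
  · rw [Category.assoc, Functor.map_comp, Category.assoc, hy, Preadditive.comp_add,
      ← Functor.map_comp_assoc, ← Functor.map_comp_assoc, BinaryBicone.inr_fst,
      BinaryBicone.inr_snd]
    simp

lemma IsExactTriangle.epi_of_mono (T : IsExactTriangle f g h) [Mono ((shift A 1).map f)] :
    Epi g := by
  have h_zero : h = 0 := by
    rw [← cancel_mono ((shift A 1).map f), T.comp_shift_map_eq_zero, zero_comp]
  obtain ⟨h', T'⟩ := T.rotate
  refine Preadditive.epi_of_cancel_zero _ fun x hx => ?_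
  obtain ⟨y, rfl⟩ := T'.exists_desc x hx
  rw [h_zero, zero_comp]

lemma exists_bicone_of_retract {M G : DerivedCat A} (i : M ⟶ G) (r : G ⟶ M) (hi : i ≫ r = 𝟙 M) :
    ∃ (N : DerivedCat A) (b : BinaryBicone M N), Nonempty b.IsBilimit ∧ b.pt = G := by
  obtain ⟨N, g, h, T⟩ := exists_isExactTriangle i
  have : IsSplitMono i := ⟨⟨r, hi⟩⟩
  have : Epi g := T.epi_of_mono
  have hg : i ≫ g = 0 := T.comp_eq_zero
  obtain ⟨y, hy⟩ : ∃ y, g ≫ y = 𝟙 G - r ≫ i := T.exists_desc _ (by simp [reassoc_of% hi])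
  refine ⟨N, ⟨G, r, g, i, y, hi, hg, ?_, ?_⟩, ⟨isBinaryBilimitOfTotal _ ?_⟩, rfl⟩
  · rw [← cancel_epi g, reassoc_of% hy]
    simp [hi]
  · rw [← cancel_epi g, reassoc_of% hy]
    simp [hg]
  · change r ≫ i + g ≫ y = 𝟙 G
    rw [hy, add_sub_cancel]

end triangle

end DerivedCat

lemma DGAlg.d_one (A : DGAlg k) : A.d 1 = 0 := by
  have := A.leibniz (p := 0) 1 (SetLike.one_mem_graded A.gr)
  simpa using this

namespace DGMod

variable {A : DGAlg k}

/-! ### Direct sums -/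

open Classical in
lemma exists_dfinsupp_of_forall_exists {J : Type*} {β γ : J → Type*} [∀ j, Zero (β j)]
    [∀ j, Zero (γ j)] (R : ∀ j, γ j → β j → Prop) (h0 : ∀ j, R j 0 0) (y : Π₀ j, β j)
    (h : ∀ j, ∃ x, R j x (y j)) : ∃ x : Π₀ j, γ j, ∀ j, R j (x j) (y j) := by
  choose f hf using h
  refine ⟨DFinsupp.mk y.support (fun j => f j), fun j => ?_⟩
  rw [DFinsupp.mk_apply]
  split_ifs with hj
  · exact hf j
  · rw [DFinsupp.notMem_support_iff.1 hj]
    exact h0 j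

section dsum

variable {J : Type u} (N : J → DGMod A)

/-- The direct sum of a family of DG modules. -/
def dsum : DGMod A where
  X q := Π₀ j, (N j).X q
  d h := DFinsupp.mapRange.addMonoidHom (fun j => (N j).d h)
  d_d h h' x := by ext j; simp [(N j).d_d]
  smul h := AddMonoidHom.mk' (fun a => DFinsupp.mapRange.addMonoidHom (fun j => (N j).smul h a))
    (fun a b => by ext; simp)
  one_smul h x := by ext j; simp [(N j).one_smul]
  mul_smul hs hsn hr hn a b x := by
    ext j
    simpa using (N j).mul_smul hs hsn hr hn a b (x j)
  leibniz hp hq hn h h₁ h₂ a x := by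
    ext j
    simpa [Units.smul_def] using (N j).leibniz hp hq hn h h₁ h₂ a (x j)

lemma dsum_ext {q : ℤ} {x y : (dsum N).X q} (h : ∀ j, (show Π₀ j, (N j).X q from x) j =
    (show Π₀ j, (N j).X q from y) j) : x = y :=
  DFinsupp.ext h

/-- The projections of a direct sum. -/
def dsumπ (j : J) : dsum N ⟶ N j where
  f q := (DFinsupp.evalAddMonoidHom j : (Π₀ j, (N j).X q) →+ (N j).X q)
  comm _ _ := rfl
  map_smul _ _ _ := rfl

open Classical in
/-- The inclusions of a direct sum. -/
def dsumι (j : J) : N j ⟶ dsum N where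
  f q := DFinsupp.singleAddHom (fun j => (N j).X q) j
  comm h _ := (DFinsupp.mapRange_single (f := fun j => (N j).d h)
    (hf := fun _ => map_zero _)).symm
  map_smul h a _ := (DFinsupp.mapRange_single (f := fun j => (N j).smul h a)
    (hf := fun _ => map_zero _)).symm

lemma dsumι_π_same (j : J) : dsumι N j ≫ dsumπ N j = 𝟙 _ := by
  classical
  ext q x
  exact DFinsupp.single_eq_same (β := fun j => (N j).X q)

lemma dsumι_π_ne {i j : J} (h : i ≠ j) : dsumι N i ≫ dsumπ N j = 0 := by
  classical
  ext q x
  exact DFinsupp.single_eq_of_ne (β := fun j => (N j).X q) h.symm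

open Classical in
lemma dsum_hom_ext {q : ℤ} {G : Type*} [AddCommGroup G] {f g : (dsum N).X q →+ G}
    (h : ∀ (j : J) (x : (N j).X q), f (Hom.f (dsumι N j) q x) = g (Hom.f (dsumι N j) q x)) :
    f = g :=
  DFinsupp.addHom_ext (β := fun j => (N j).X q) h

open Classical in
/-- The additive map out of a direct sum with given components. -/
def dsumLift {q : ℤ} {G : Type*} [AddCommGroup G] (f : ∀ j, (N j).X q →+ G) :
    (dsum N).X q →+ G :=
  DFinsupp.liftAddHom (β := fun j => (N j).X q) f

lemma dsumLift_ι {q : ℤ} {G : Type*} [AddCommGroup G] (f : ∀ j, (N j).X q →+ G) (j : J)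
    (x : (N j).X q) : dsumLift N f (Hom.f (dsumι N j) q x) = f j x := by
  classical
  exact DFinsupp.liftAddHom_apply_single f j x

variable {N}

/-- The morphism out of a direct sum with given components. -/
def dsumDesc {Z : DGMod A} (g : ∀ j, N j ⟶ Z) : dsum N ⟶ Z where
  f q := dsumLift N (fun j => Hom.f (g j) q)
  comm {q q'} h x := by
    refine DFunLike.congr_fun (f := (dsumLift N (fun j => Hom.f (g j) q')).comp ((dsum N).d h))
      (g := (Z.d h).comp (dsumLift N (fun j => Hom.f (g j) q))) (dsum_hom_ext N fun j x => ?_) x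
    simp only [AddMonoidHom.comp_apply, ← Hom.comm, dsumLift_ι]
  map_smul {p q n} h a x := by
    refine DFunLike.congr_fun
      (f := (dsumLift N (fun j => Hom.f (g j) n)).comp ((dsum N).smul h a))
      (g := (Z.smul h a).comp (dsumLift N (fun j => Hom.f (g j) q)))
      (dsum_hom_ext N fun j x => ?_) x
    simp only [AddMonoidHom.comp_apply, ← Hom.map_smul, dsumLift_ι]

lemma dsumι_f_desc {Z : DGMod A} (g : ∀ j, N j ⟶ Z) (j : J) (q : ℤ) (x : (N j).X q) :
    Hom.f (dsumDesc g) q (Hom.f (dsumι N j) q x) = Hom.f (g j) q x :=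
  dsumLift_ι N _ j x

lemma dsumι_desc {Z : DGMod A} (g : ∀ j, N j ⟶ Z) (j : J) : dsumι N j ≫ dsumDesc g = g j := by
  ext q x
  exact dsumι_f_desc g j q x

lemma dsum_morphism_ext {Z : DGMod A} {f g : dsum N ⟶ Z}
    (h : ∀ j, dsumι N j ≫ f = dsumι N j ≫ g) : f = g := by
  ext q x
  exact DFunLike.congr_fun (dsum_hom_ext N fun j x => congrArg (fun t => Hom.f t q x) (h j)) x

/-- A null homotopy on a direct sum from null homotopies on the summands. -/
def NullHomotopy.dsum {Z : DGMod A} {φ : dsum N ⟶ Z} (s : ∀ j, NullHomotopy (dsumι N j ≫ φ)) :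
    NullHomotopy φ where
  s h := dsumLift N (fun j => (s j).s h)
  comm {q q' q''} h h' x := by
    refine DFunLike.congr_fun (f := Hom.f φ q) (g := (Z.d h).comp (dsumLift N fun j => (s j).s h) +
      (dsumLift N fun j => (s j).s h').comp ((DGMod.dsum N).d h')) (dsum_hom_ext N fun j x => ?_) x
    simp only [AddMonoidHom.comp_apply, AddMonoidHom.add_apply, ← Hom.comm, dsumLift_ι]
    exact (s j).comm h h' x
  map_smul {p q q' n n'} hq hn h h' a x := by
    refine DFunLike.congr_fun (f := (dsumLift N fun j => (s j).s hn).comp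
      ((DGMod.dsum N).smul h a)) (g := p.negOnePow • (Z.smul h' a).comp
        (dsumLift N fun j => (s j).s hq)) (dsum_hom_ext N fun j x => ?_) x
    simp only [AddMonoidHom.comp_apply, ← Hom.map_smul, dsumLift_ι]
    refine ((s j).map_smul hq hn h h' a x).trans ?_
    change _ = p.negOnePow • (Z.smul h' a (dsumLift N _ (Hom.f (dsumι N j) q x)))
    rw [dsumLift_ι]

lemma NullHomotopy.dsum_s_ι {Z : DGMod A} {φ : DGMod.dsum N ⟶ Z}
    (s : ∀ j, NullHomotopy (dsumι N j ≫ φ)) {q q' : ℤ} (h : q' + 1 = q) (j : J)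
    (x : (N j).X q) :
    (NullHomotopy.dsum s).s h (Hom.f (dsumι N j) q x) = (s j).s h x :=
  dsumLift_ι N _ j x

lemma dsum_d_eq_zero {q : ℤ} {x : Π₀ j, (N j).X q} :
    (dsum N).d rfl x = 0 ↔ ∀ j, (N j).d rfl (x j) = 0 := by
  constructor
  · intro h j
    exact DFunLike.congr_fun (F := Π₀ j, (N j).X (q + 1)) h j
  · intro h
    exact DFinsupp.ext (fun j => h j)

lemma dsum_mem_coboundaries_iff {q : ℤ} {x : Π₀ j, (N j).X q} :
    (show (dsum N).X q from x) ∈ (dsum N).coboundaries q ↔ ∀ j, x j ∈ (N j).coboundaries q := by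
  constructor
  · rintro ⟨y, hy⟩ j
    exact ⟨(show Π₀ j, (N j).X (q - 1) from y) j, DFunLike.congr_fun (F := Π₀ j, (N j).X q) hy j⟩
  · intro h
    obtain ⟨y, hy⟩ := exists_dfinsupp_of_forall_exists
      (fun j (y : (N j).X (q - 1)) x => (N j).d (show q - 1 + 1 = q by lia) y = x)
      (fun j => map_zero _) x h
    exact ⟨y, DFinsupp.ext hy⟩

variable {M : J → DGMod A}

/-- The direct sum of a family of morphisms. -/
def dsumMap (s : ∀ j, M j ⟶ N j) : dsum M ⟶ dsum N := dsumDesc fun j => s j ≫ dsumι N j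

lemma dsumι_dsumMap (s : ∀ j, M j ⟶ N j) (j : J) :
    dsumι M j ≫ dsumMap s = s j ≫ dsumι N j :=
  dsumι_desc _ j

lemma dsumMap_dsumπ (s : ∀ j, M j ⟶ N j) (j : J) : dsumMap s ≫ dsumπ N j = dsumπ M j ≫ s j := by
  refine dsum_morphism_ext fun i => ?_
  rw [← Category.assoc, dsumι_dsumMap, Category.assoc]
  by_cases h : i = j
  · subst h
    rw [dsumι_π_same, ← Category.assoc, dsumι_π_same]
    simp
  · rw [dsumι_π_ne N h, ← Category.assoc, dsumι_π_ne M h]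
    simp

lemma dsumMap_apply (s : ∀ j, M j ⟶ N j) (q : ℤ) (x : Π₀ j, (M j).X q) (j : J) :
    (show Π₀ j, (N j).X q from Hom.f (dsumMap s) q x) j = Hom.f (s j) q (x j) :=
  congrArg (fun t => Hom.f t q x) (dsumMap_dsumπ s j)

lemma quasiIso_dsumMap (s : ∀ j, M j ⟶ N j) (hs : ∀ j, quasiIso A (s j)) :
    quasiIso A (dsumMap s) := by
  have hs' j q := (quasiIso_iff _).1 (hs j) q
  refine (quasiIso_iff _).2 fun q => ⟨fun (x : Π₀ j, (M j).X q) hx h => ?_, fun y hy => ?_⟩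
  · refine dsum_mem_coboundaries_iff.2 fun j => (hs' j q).1 _ (dsum_d_eq_zero.1 hx j) ?_
    rw [← dsumMap_apply]
    exact dsum_mem_coboundaries_iff.1 h j
  · obtain ⟨x, hx⟩ := exists_dfinsupp_of_forall_exists
      (fun j (x : (M j).X q) (y : (N j).X q) => (M j).d rfl x = 0 ∧
        Hom.f (s j) q x - y ∈ (N j).coboundaries q)
      (fun j => ⟨map_zero _, by rw [map_zero, sub_zero]; exact zero_mem _⟩) y
      (fun j => (hs' j q).2 _ (dsum_d_eq_zero.1 hy j))
    refine ⟨x, dsum_d_eq_zero.2 fun j => (hx j).1, dsum_mem_coboundaries_iff.2 fun j => ?_⟩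
    have h := (hx j).2
    rw [← dsumMap_apply] at h
    exact h

/-- Suspensions commute with direct sums. -/
def shiftDsumIso (i : ℤ) :
    (shiftFun A i).obj (dsum N) ≅ dsum (fun j => (shiftFun A i).obj (N j)) :=
  isoMk (fun q => AddEquiv.refl (Π₀ j, (N j).X (q + i)))
    (fun _ _ => dsum_ext _ fun _ => rfl)
    (fun _ _ _ => dsum_ext _ fun _ => rfl)

end dsum

/-! ### Morphisms out of suspensions of `A` -/

lemma units_smul_smul (M : DGMod A) {p q n : ℤ} (h : p + q = n) (e : ℤˣ) (a : A.gr p)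
    (x : M.X q) : M.smul h (e • a) x = e • M.smul h a x :=
  DFunLike.congr_fun (map_units_smul (M.smul h) e a) x

lemma smul_of_eq_one (M : DGMod A) {p q n : ℤ} (hp : p = 0) (h : p + q = n) (a : A.gr p)
    (ha : a.1 = 1) (x : M.X q) : M.smul h a x = M.cast (by lia) x := by
  subst hp
  obtain rfl : q = n := by lia
  obtain rfl : a = A.oneGr := Subtype.ext ha
  exact M.one_smul h x

/-- The suspension `Σ^i A`, the free DG module on a generator of degree `-i`. -/
abbrev free (A : DGAlg k) (i : ℤ) : DGMod A := (shiftFun A i).obj (self A)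

/-- The unit of `A`, as the generator of `Σ^i A` in degree `q = -i`. -/
def gen (A : DGAlg k) {i q : ℤ} (h : q + i = 0) : (free A i).X q :=
  (⟨1, h ▸ SetLike.one_mem_graded A.gr⟩ : A.gr (q + i))

lemma d_gen {i q q' : ℤ} (h : q + i = 0) (h' : q + 1 = q') : (free A i).d h' (gen A h) = 0 := by
  refine (shift_d i (self A) h' _).trans ?_
  have : (self A).d (show (q + i) + 1 = q' + i by lia) (gen A h) = 0 := Subtype.ext A.d_one
  rw [this, smul_zero]
  rfl

/-- The morphism `Σ^i A ⟶ Y` that sends the generator to a cocycle `y` of degree `-i`. The sign is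
forced by the sign in the action of `A` on `Σ^i A`. -/
def freeMap {i q₀ : ℤ} (hi : q₀ + i = 0) {Y : DGMod A} (y : Y.X q₀) (hy : Y.d rfl y = 0) :
    free A i ⟶ Y where
  f q := ((q + i) * i).negOnePow • (Y.smul (show (q + i) + q₀ = q by lia)).flip y
  comm {q q'} h (b : A.gr (q + i)) := by
    subst h
    change ((q + 1 + i) * i).negOnePow • Y.smul _
      (i.negOnePow • A.dGr (show q + i + 1 = q + 1 + i by lia) b) y =
      Y.d rfl (((q + i) * i).negOnePow • Y.smul _ b y)
    rw [map_units_smul (Y.d rfl),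
      Y.leibniz (show q + i + 1 = q + 1 + i by lia) (rfl : q₀ + 1 = q₀ + 1)
        (rfl : q + 1 = q + 1) (by lia) (by lia) (by lia), hy, map_zero, smul_zero, add_zero,
      units_smul_smul, smul_smul, ← Int.negOnePow_add]
    congr 1
    exact (Int.negOnePow_eq_iff _ _).2 ⟨i, by ring⟩
  map_smul {p q n} h a (b : A.gr (q + i)) := by
    change ((n + i) * i).negOnePow • Y.smul _
      ((p * i).negOnePow • A.mulGr (show p + (q + i) = n + i by lia) a b) y =
      Y.smul h a (((q + i) * i).negOnePow • Y.smul _ b y)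
    rw [map_units_smul (Y.smul h a), ← Y.mul_smul (show p + (q + i) = n + i by lia)
      (show n + i + q₀ = n by lia), units_smul_smul, smul_smul, ← Int.negOnePow_add]
    congr 1
    subst h
    exact (Int.negOnePow_eq_iff _ _).2 ⟨p * i, by ring⟩

lemma freeMap_f {i q₀ : ℤ} (hi : q₀ + i = 0) {Y : DGMod A} (y : Y.X q₀) (hy : Y.d rfl y = 0)
    (q : ℤ) (b : A.gr (q + i)) : Hom.f (freeMap hi y hy) q b =
      ((q + i) * i).negOnePow • Y.smul (show (q + i) + q₀ = q by lia) b y := rfl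

lemma freeMap_gen {i q₀ : ℤ} (hi : q₀ + i = 0) {Y : DGMod A} (y : Y.X q₀) (hy : Y.d rfl y = 0) :
    Hom.f (freeMap hi y hy) q₀ (gen A hi) = y := by
  refine (freeMap_f hi y hy q₀ (gen A hi)).trans ?_
  have := Y.smul_of_eq_one hi (show q₀ + i + q₀ = q₀ by lia) (gen A hi) rfl y
  rw [cast_rfl] at this
  refine (congrArg _ this).trans ?_
  rw [hi]
  simp

lemma free_eq_smul_gen {i q₀ : ℤ} (hi : q₀ + i = 0) (q : ℤ) (b : A.gr (q + i)) :
    (show (free A i).X q from b) = ((q + i) * i).negOnePow •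
      (free A i).smul (show (q + i) + q₀ = q by lia) b (gen A hi) := by
  have h₁ := shift_smul i (self A) (show (q + i) + q₀ = q by lia) b (gen A hi)
  refine Eq.trans ?_ (congrArg _ h₁).symm
  refine Eq.trans ?_ (smul_smul _ _ _).symm
  rw [Int.units_mul_self]
  refine Eq.trans ?_ (_root_.one_smul _ _).symm
  exact Subtype.ext (mul_one b.1).symm

lemma free_hom_f {i q₀ : ℤ} (hi : q₀ + i = 0) {Y : DGMod A} (f : free A i ⟶ Y) (q : ℤ)
    (b : A.gr (q + i)) : Hom.f f q b = ((q + i) * i).negOnePow •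
      Y.smul (show (q + i) + q₀ = q by lia) b (Hom.f f q₀ (gen A hi)) :=
  (congrArg _ (free_eq_smul_gen hi q b)).trans
    ((map_units_smul (Hom.f f q) _ _).trans (congrArg _ (Hom.map_smul f _ _ _)))

lemma free_hom_ext {i q₀ : ℤ} (hi : q₀ + i = 0) {Y : DGMod A} {f g : free A i ⟶ Y}
    (h : Hom.f f q₀ (gen A hi) = Hom.f g q₀ (gen A hi)) : f = g := by
  ext q b
  exact (free_hom_f hi f q b).trans
    ((congrArg _ (congrArg _ h)).trans (free_hom_f hi g q b).symm)

/-- The null homotopy of a morphism `f : Σ^i A ⟶ Y` that sends the generator to the coboundary of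
`m`. It is determined by sending the generator to `m`. -/
def freeNullHomotopy {i q₀ q₁ : ℤ} (hi : q₀ + i = 0) {Y : DGMod A} {f : free A i ⟶ Y}
    (hq : q₁ + 1 = q₀) (m : Y.X q₁) (hm : Y.d hq m = Hom.f f q₀ (gen A hi)) :
    NullHomotopy f where
  s {q q'} h := ((q + i) * (i + 1)).negOnePow • (Y.smul (show (q + i) + q₁ = q' by lia)).flip m
  comm {q q' q''} h h' (b : A.gr (q + i)) := by
    subst h h'
    change Hom.f f (q' + 1) b =
      Y.d rfl (((q' + 1 + i) * (i + 1)).negOnePow • Y.smul _ b m) +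
        ((q' + 1 + 1 + i) * (i + 1)).negOnePow • Y.smul _
          (i.negOnePow • A.dGr (show q' + 1 + i + 1 = q' + 1 + 1 + i by lia) b) m
    have h_even : ((q' + 1 + i) * (i + 1) + (q' + 1 + i)).negOnePow =
        ((q' + 1 + i) * i).negOnePow := (Int.negOnePow_eq_iff _ _).2 ⟨q' + 1 + i, by ring⟩
    have h_odd : ((q' + 1 + 1 + i) * (i + 1) + i).negOnePow =
        -((q' + 1 + i) * (i + 1)).negOnePow := by
      rw [← Int.negOnePow_succ, Int.negOnePow_eq_iff]
      exact ⟨i, by ring⟩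
    rw [free_hom_f hi f, ← hm, map_units_smul,
      Y.leibniz (show q' + 1 + i + 1 = q' + 1 + 1 + i by lia) hq (rfl : q' + 1 = q' + 1) (by lia)
        (by lia) (by lia), units_smul_smul, smul_add, smul_smul, smul_smul, ← Int.negOnePow_add,
      ← Int.negOnePow_add, h_even, h_odd, Units.neg_smul]
    abel
  map_smul {p q q' n n'} hq' hn h h' a (b : A.gr (q + i)) := by
    change ((n + i) * (i + 1)).negOnePow • Y.smul _
      ((p * i).negOnePow • A.mulGr (show p + (q + i) = n + i by lia) a b) m =
      p.negOnePow • Y.smul h' a (((q + i) * (i + 1)).negOnePow • Y.smul _ b m)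
    rw [map_units_smul (Y.smul h' a), ← Y.mul_smul (show p + (q + i) = n + i by lia)
      (show n + i + q₁ = n' by lia), units_smul_smul, smul_smul, smul_smul, ← Int.negOnePow_add,
      ← Int.negOnePow_add]
    congr 1
    subst h
    exact (Int.negOnePow_eq_iff _ _).2 ⟨p * i, by ring⟩

lemma freeNullHomotopy_gen {i q₀ q₁ : ℤ} (hi : q₀ + i = 0) {Y : DGMod A} {f : free A i ⟶ Y}
    (hq : q₁ + 1 = q₀) (m : Y.X q₁) (hm : Y.d hq m = Hom.f f q₀ (gen A hi)) :
    (freeNullHomotopy hi hq m hm).s hq (gen A hi) = m := by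
  change ((q₀ + i) * (i + 1)).negOnePow • Y.smul _ (gen A hi) m = m
  have := Y.smul_of_eq_one hi (show q₀ + i + q₁ = q₁ by lia) (gen A hi) rfl m
  rw [cast_rfl] at this
  refine (congrArg _ this).trans ?_
  rw [hi]
  simp

lemma nonempty_nullHomotopy_free {i q₀ : ℤ} (hi : q₀ + i = 0) {Y : DGMod A} {f : free A i ⟶ Y}
    (h : Hom.f f q₀ (gen A hi) ∈ Y.coboundaries q₀) : Nonempty (NullHomotopy f) := by
  obtain ⟨m, hm⟩ := (mem_coboundaries_iff (show q₀ - 1 + 1 = q₀ by lia)).1 h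
  exact ⟨freeNullHomotopy hi _ m hm⟩

end DGMod

namespace DerivedCat

open DGMod

variable {A : DGAlg k}

/-! ### Coproducts and small objects -/

section

variable {J : Type u} (N : J → DGMod A)

lemma exists_dsum_desc {Z : DerivedCat A} (g : ∀ j, (Q A).obj (N j) ⟶ Z) :
    ∃ y : (Q A).obj (dsum N) ⟶ Z, ∀ j, (Q A).map (dsumι N j) ≫ y = g j := by
  obtain ⟨Z, rfl⟩ := Q_obj_surjective Z
  choose N' s f hs h using fun j => exists_right_fraction (g j)
  have := isIso_Q_map (quasiIso_dsumMap s hs)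
  refine ⟨inv ((Q A).map (dsumMap s)) ≫ (Q A).map (dsumDesc f), fun j => ?_⟩
  have := isIso_Q_map (hs j)
  rw [← cancel_epi ((Q A).map (s j)), h j, ← Functor.map_comp_assoc, ← dsumι_dsumMap,
    Functor.map_comp_assoc, IsIso.hom_inv_id_assoc, ← Functor.map_comp, dsumι_desc]

variable {N}

lemma dsum_eq_zero {Z : DerivedCat A} (y : (Q A).obj (dsum N) ⟶ Z)
    (h : ∀ j, (Q A).map (dsumι N j) ≫ y = 0) : y = 0 := by
  obtain ⟨Z, rfl⟩ := Q_obj_surjective Z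
  obtain ⟨Z', g, s, hs, hg⟩ := exists_left_fraction y
  have := isIso_Q_map hs
  have h₀ (j : J) : (Q A).map (dsumι N j ≫ g) = 0 := by
    rw [Functor.map_comp, ← hg, ← Category.assoc, h, zero_comp]
  choose N' t ht n using fun j => exists_precomp_null (h₀ j)
  have := isIso_Q_map (quasiIso_dsumMap t ht)
  rw [← cancel_mono ((Q A).map s), zero_comp, hg, ← cancel_epi ((Q A).map (dsumMap t)), comp_zero,
    ← Functor.map_comp]
  refine Q_map_eq_zero (NullHomotopy.dsum fun j => (n j).some.ofEq ?_)
  rw [← Category.assoc (dsumι N' j), dsumι_dsumMap, Category.assoc]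

variable (N) in
/-- Direct sums of DG modules are coproducts in the derived category. -/
def isColimitDsum : IsColimit (Cofan.mk ((Q A).obj (dsum N)) (fun j => (Q A).map (dsumι N j))) :=
  Cofan.IsColimit.mk _ (fun s => (exists_dsum_desc N s.inj).choose)
    (fun s => (exists_dsum_desc N s.inj).choose_spec)
    (fun s m hm => by
      rw [← sub_eq_zero]
      refine dsum_eq_zero _ fun j => ?_
      rw [Preadditive.comp_sub, (exists_dsum_desc N s.inj).choose_spec, sub_eq_zero]
      exact hm j)

lemma comp_dsumι_dsumπ_same {M : DerivedCat A} (j : J) (g : M ⟶ (Q A).obj (N j)) :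
    (g ≫ (Q A).map (dsumι N j)) ≫ (Q A).map (dsumπ N j) = g := by
  rw [Category.assoc, ← Functor.map_comp, dsumι_π_same, CategoryTheory.Functor.map_id,
    Category.comp_id]

lemma comp_dsumι_dsumπ_ne {M : DerivedCat A} {i j : J} (h : i ≠ j) (g : M ⟶ (Q A).obj (N i)) :
    (g ≫ (Q A).map (dsumι N i)) ≫ (Q A).map (dsumπ N j) = 0 := by
  rw [Category.assoc, ← Functor.map_comp, dsumι_π_ne N h, Functor.map_zero, comp_zero]

variable (N) in
/-- The morphisms to a direct sum that are finite sums of morphisms through the summands. -/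
def finiteMaps (M : DerivedCat A) : AddSubgroup (M ⟶ (Q A).obj (dsum N)) :=
  AddSubgroup.closure {f | ∃ (j : J) (g : M ⟶ (Q A).obj (N j)), f = g ≫ (Q A).map (dsumι N j)}

lemma comp_ι_mem_finiteMaps {M : DerivedCat A} (j : J) (g : M ⟶ (Q A).obj (N j)) :
    g ≫ (Q A).map (dsumι N j) ∈ finiteMaps N M :=
  AddSubgroup.subset_closure ⟨j, g, rfl⟩

lemma comp_mem_finiteMaps {M M' : DerivedCat A} (p : M' ⟶ M) {f : M ⟶ (Q A).obj (dsum N)}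
    (hf : f ∈ finiteMaps N M) : p ≫ f ∈ finiteMaps N M' := by
  induction hf using AddSubgroup.closure_induction with
  | mem f h =>
    obtain ⟨j, g, rfl⟩ := h
    rw [← Category.assoc]
    exact comp_ι_mem_finiteMaps j _
  | zero => rw [comp_zero]; exact zero_mem _
  | add f g _ _ hf hg => rw [Preadditive.comp_add]; exact add_mem hf hg
  | neg f _ hf => rw [Preadditive.comp_neg]; exact neg_mem hf

lemma exists_eq_sum_of_mem_finiteMaps {M : DerivedCat A} {f : M ⟶ (Q A).obj (dsum N)}
    (hf : f ∈ finiteMaps N M) : ∃ F : Finset J, ∀ F', F ⊆ F' →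
      f = ∑ j ∈ F', (f ≫ (Q A).map (dsumπ N j)) ≫ (Q A).map (dsumι N j) := by
  classical
  induction hf using AddSubgroup.closure_induction with
  | mem f h =>
    obtain ⟨j, g, rfl⟩ := h
    refine ⟨{j}, fun F' hF' => ?_⟩
    rw [Finset.sum_eq_single_of_mem j (hF' (Finset.mem_singleton_self j)), comp_dsumι_dsumπ_same]
    intro i _ hi
    rw [comp_dsumι_dsumπ_ne hi.symm, zero_comp]
  | zero => exact ⟨∅, fun F' _ => by simp⟩
  | add f g _ _ hf hg =>
    obtain ⟨F, hF⟩ := hf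
    obtain ⟨G, hG⟩ := hg
    refine ⟨F ∪ G, fun F' hF' => ?_⟩
    simp only [Preadditive.add_comp, Finset.sum_add_distrib]
    rw [← hF F' (Finset.union_subset_left hF'), ← hG F' (Finset.union_subset_right hF')]
  | neg f _ hf =>
    obtain ⟨F, hF⟩ := hf
    refine ⟨F, fun G hG => ?_⟩
    simp only [Preadditive.neg_comp, Finset.sum_neg_distrib]
    rw [← hF G hG]

lemma finite_setOf_comp_dsumπ_ne_zero {M : DerivedCat A} {f : M ⟶ (Q A).obj (dsum N)}
    (hf : f ∈ finiteMaps N M) : {j | f ≫ (Q A).map (dsumπ N j) ≠ 0}.Finite := by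
  obtain ⟨F, hF⟩ := exists_eq_sum_of_mem_finiteMaps hf
  refine F.finite_toSet.subset fun j hj => ?_
  by_contra hjF
  refine hj ?_
  rw [hF F (Finset.Subset.refl F), Preadditive.sum_comp]
  exact Finset.sum_eq_zero fun i hi => comp_dsumι_dsumπ_ne (ne_of_mem_of_not_mem hi hjF) _

end

/-- An object is small if every morphism from it to a direct sum of DG modules is a finite sum of
morphisms through the summands. -/
def IsSmall (M : DerivedCat A) : Prop :=
  ∀ (J : Type u) (N : J → DGMod A) (f : M ⟶ (Q A).obj (dsum N)), f ∈ finiteMaps N M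

lemma IsSmall.of_retract {M M' : DerivedCat A} (h : IsSmall M') (i : M ⟶ M') (r : M' ⟶ M)
    (hi : i ≫ r = 𝟙 M) : IsSmall M := fun J N f => by
  have := comp_mem_finiteMaps i (h J N (r ≫ f))
  rwa [← Category.assoc, hi, Category.id_comp] at this

lemma isSmall_of_isZero {M : DerivedCat A} (h : IsZero M) : IsSmall M := fun J N f => by
  rw [h.eq_of_src f 0]; exact zero_mem _

lemma IsSmall.bicone {M M' : DerivedCat A} (h : IsSmall M) (h' : IsSmall M')
    (b : BinaryBicone M M') (hb : b.IsBilimit) : IsSmall b.pt := fun J N f => by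
  rw [← Category.id_comp f, ← IsBilimit.binary_total hb, Preadditive.add_comp, Category.assoc,
    Category.assoc]
  exact add_mem (comp_mem_finiteMaps _ (h J N _)) (comp_mem_finiteMaps _ (h' J N _))

lemma IsExactTriangle.isSmall {L M N : DerivedCat A} {f : L ⟶ M} {g : M ⟶ N}
    {h : N ⟶ (shift A 1).obj L} (T : IsExactTriangle f g h) (hL : IsSmall L) (hN : IsSmall N) :
    IsSmall M := fun J P x => by
  obtain ⟨F, hF⟩ := exists_eq_sum_of_mem_finiteMaps (hL J P (f ≫ x))
  let x' := ∑ j ∈ F, (x ≫ (Q A).map (dsumπ P j)) ≫ (Q A).map (dsumι P j)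
  have hx' : f ≫ (x - x') = 0 := by
    rw [Preadditive.comp_sub, sub_eq_zero, Preadditive.comp_sum]
    simpa only [Category.assoc] using hF F (Finset.Subset.refl F)
  obtain ⟨y, hy⟩ := T.exists_desc (x - x') hx'
  rw [← sub_add_cancel x x', ← hy]
  exact add_mem (comp_mem_finiteMaps _ (hN J P y))
    (sum_mem fun j _ => comp_ι_mem_finiteMaps j _)

lemma exists_eq_Q_map_free {i : ℤ} {Y : DGMod A} (f : (Q A).obj (free A i) ⟶ (Q A).obj Y) :
    ∃ g : free A i ⟶ Y, f = (Q A).map g := by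
  obtain ⟨Y', g, s, hs, h⟩ := exists_left_fraction f
  have hi : -i + i = 0 := by lia
  have := isIso_Q_map hs
  have hc : Y'.d rfl (Hom.f g _ (gen A hi)) = 0 := by rw [← Hom.comm, d_gen, map_zero]
  obtain ⟨y, hy, hb⟩ := ((DGMod.quasiIso_iff _).1 hs _).2 _ hc
  refine ⟨freeMap hi y hy, ?_⟩
  rw [← cancel_mono ((Q A).map s), h, eq_comm, ← sub_eq_zero, ← Functor.map_comp,
    ← Functor.map_sub]
  have hgen : Hom.f (freeMap hi y hy ≫ s - g) (-i) (gen A hi) ∈ Y'.coboundaries (-i) := by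
    rw [sub_eq_add_neg, add_f, neg_f, comp_f, freeMap_gen, ← sub_eq_add_neg]
    exact hb
  exact Q_map_eq_zero (nonempty_nullHomotopy_free hi hgen).some

lemma isSmall_free (i : ℤ) : IsSmall ((Q A).obj (free A i)) := fun J N f => by
  classical
  obtain ⟨g, rfl⟩ := exists_eq_Q_map_free f
  have hi : -i + i = 0 := by lia
  let x : Π₀ j, (N j).X (-i) := Hom.f g (-i) (gen A hi)
  have hg : g = ∑ j ∈ x.support, (g ≫ dsumπ N j) ≫ dsumι N j := by
    refine free_hom_ext hi ?_
    let ev : (free A i ⟶ dsum N) →+ (dsum N).X (-i) :=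
      AddMonoidHom.mk' (fun φ => Hom.f φ (-i) (gen A hi)) (fun _ _ => rfl)
    change x = ev _
    rw [map_sum]
    exact (DFinsupp.sum_single (f := x)).symm
  rw [hg, Functor.map_sum]
  refine sum_mem fun j _ => ?_
  rw [Functor.map_comp]
  exact comp_ι_mem_finiteMaps j _

/-! ### Compact objects are the small ones -/

lemma closure_eq_top_of_isColimit {J : Type*} [Category* J] {F : J ⥤ AddCommGrpCat.{u}}
    (c : Cocone F) (hc : IsColimit c) :
    AddSubgroup.closure {x : c.pt | ∃ (j : J) (y : F.obj j), x = c.ι.app j y} = ⊤ := by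
  let S := AddSubgroup.closure {x : c.pt | ∃ (j : J) (y : F.obj j), x = c.ι.app j y}
  have h : AddCommGrpCat.ofHom (QuotientAddGroup.mk' S) = 0 := hc.hom_ext fun j => by
    ext y
    exact (QuotientAddGroup.eq_zero_iff _).2 (AddSubgroup.subset_closure ⟨j, y, rfl⟩)
  refine (AddSubgroup.eq_top_iff' _).2 fun x => (QuotientAddGroup.eq_zero_iff (N := S) x).1 ?_
  exact congrArg (fun f => f.hom x) h

lemma IsSmall.of_compact {M : DerivedCat A} (hM : compact A M) : IsSmall M := fun J N f => by
  have := hM J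
  have h := closure_eq_top_of_isColimit _ (isColimitOfPreserves
    (preadditiveCoyoneda.obj (Opposite.op M)) (isColimitDsum N))
  have hf : f ∈ (⊤ : AddSubgroup (M ⟶ (Q A).obj (dsum N))) := trivial
  refine AddSubgroup.closure_mono ?_ (h.symm ▸ hf)
  rintro _ ⟨⟨j⟩, y, rfl⟩
  exact ⟨j, y, rfl⟩

section

variable {M : DerivedCat A} {J : Type u} {N : J → DGMod A} {G : Type*} [AddCommGroup G]

lemma IsSmall.addMonoidHom_ext (hM : IsSmall M) {d d' : (M ⟶ (Q A).obj (dsum N)) →+ G}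
    (h : ∀ j (g : M ⟶ (Q A).obj (N j)),
      d (g ≫ (Q A).map (dsumι N j)) = d' (g ≫ (Q A).map (dsumι N j))) : d = d' :=
  AddMonoidHom.ext fun f =>
    (AddSubgroup.closure_le (d.eqLocus d')).2 (by rintro _ ⟨j, g, rfl⟩; exact h j g) (hM J N f)

lemma IsSmall.exists_addMonoidHom (hM : IsSmall M) (e : ∀ j, (M ⟶ (Q A).obj (N j)) →+ G) :
    ∃ d : (M ⟶ (Q A).obj (dsum N)) →+ G, ∀ j (g : M ⟶ (Q A).obj (N j)),
      d (g ≫ (Q A).map (dsumι N j)) = e j g := by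
  have hfin (f : M ⟶ (Q A).obj (dsum N)) :
      (Function.support fun j => e j (f ≫ (Q A).map (dsumπ N j))).Finite :=
    (finite_setOf_comp_dsumπ_ne_zero (hM J N f)).subset fun j hj h =>
      hj ((congrArg (e j) h).trans (map_zero _))
  refine ⟨AddMonoidHom.mk' (fun f => ∑ᶠ j, e j (f ≫ (Q A).map (dsumπ N j))) fun f g => ?_,
    fun j g => ?_⟩
  · rw [← finsum_add_distrib (hfin f) (hfin g)]
    simp only [Preadditive.add_comp, map_add]
  · change ∑ᶠ i, e i ((g ≫ (Q A).map (dsumι N j)) ≫ (Q A).map (dsumπ N i)) = _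
    rw [finsum_eq_single _ j fun i hi => by rw [comp_dsumι_dsumπ_ne hi.symm, map_zero],
      comp_dsumι_dsumπ_same]

end

lemma IsSmall.compact {M : DerivedCat A} (hM : IsSmall M) : compact A M := fun J => by
  refine @preservesColimitsOfShape_of_discrete _ _ _ _ _ _ fun X => ?_
  choose N hN using fun j => Q_obj_surjective (X j)
  obtain rfl : (fun j => (Q A).obj (N j)) = X := funext hN
  refine preservesColimit_of_preserves_colimit_cocone (isColimitDsum N) ?_
  choose d hd using fun s : Cocone (Discrete.functor (fun j => (Q A).obj (N j)) ⋙
      preadditiveCoyoneda.obj (Opposite.op M)) =>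
    hM.exists_addMonoidHom fun j => show (M ⟶ (Q A).obj (N j)) →+ s.pt from (s.ι.app ⟨j⟩).hom
  exact
    { desc := fun s => AddCommGrpCat.ofHom (d s)
      fac := fun s ⟨j⟩ => by
        ext g
        exact hd s j g
      uniq := fun s m hm => AddCommGrpCat.hom_ext <| hM.addMonoidHom_ext fun j g =>
        (congrArg (fun t => t.hom g) (hm ⟨j⟩)).trans (hd s j g).symm }

end DerivedCat

namespace DGMod

variable {A : DGAlg k}

/-! ### Killing the cohomology of a cone -/

/-- The semifree DG modules of length at most `n`: those built from zero by taking `n` times the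
cone of a morphism out of a direct sum of suspensions of `A`. -/
inductive IsSemifree : ℕ → DGMod A → Prop
  | zero : IsSemifree 0 (zero A)
  | cone {n : ℕ} {F : DGMod A} {J : Type u} (i : J → ℤ)
      (ψ : dsum (fun j => free A (i j)) ⟶ F) : IsSemifree n F → IsSemifree (n + 1) (cone ψ)

section killing

variable {F M : DGMod A} (p : F ⟶ M)

/-- The cocycles of the cone of `p`, with the sign of the component in `F` changed. -/
def ConeCocycle : Type u :=
  Σ q : ℤ, {w : F.X (q + 1) × M.X q // F.d rfl w.1 = 0 ∧ M.d rfl w.2 = Hom.f p (q + 1) w.1}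

/-- The morphism to `F` out of a direct sum of suspensions of `A`, one for each cocycle of the cone
of `p`, that sends each generator to the component in `F` of the cocycle. -/
def killMap : dsum (fun e : ConeCocycle p => free A (-(e.1 + 1))) ⟶ F :=
  dsumDesc (fun e => freeMap (add_neg_cancel (e.1 + 1)) e.2.1.1 e.2.2.1)

lemma killMap_gen (e : ConeCocycle p) :
    Hom.f (killMap p) (e.1 + 1) (Hom.f (dsumι _ e) (e.1 + 1) (gen A (add_neg_cancel (e.1 + 1)))) =
      e.2.1.1 :=
  (dsumι_f_desc _ e _ _).trans (freeMap_gen _ _ _)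

lemma d_eq_killMap_comp_gen (e : ConeCocycle p) :
    M.d rfl e.2.1.2 = Hom.f (dsumι _ e ≫ killMap p ≫ p) (e.1 + 1)
      (gen A (add_neg_cancel (e.1 + 1))) :=
  e.2.2.2.trans (congrArg (Hom.f p (e.1 + 1)) (killMap_gen p e)).symm

/-- The null homotopy of `killMap p ≫ p` given by the components in `M` of the cocycles. -/
def killNullHomotopy : NullHomotopy (killMap p ≫ p) :=
  NullHomotopy.dsum fun e =>
    freeNullHomotopy (add_neg_cancel (e.1 + 1)) rfl e.2.1.2 (d_eq_killMap_comp_gen p e)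

lemma killNullHomotopy_gen (e : ConeCocycle p) :
    (killNullHomotopy p).s (rfl : e.1 + 1 = e.1 + 1) (Hom.f (dsumι _ e) (e.1 + 1)
      (gen A (add_neg_cancel (e.1 + 1)))) = e.2.1.2 := by
  rw [killNullHomotopy, NullHomotopy.dsum_s_ι, freeNullHomotopy_gen]

/-- The extension of `p` to the cone of `killMap p`. -/
def killExt : cone (killMap p) ⟶ M := coneDesc (killMap p) p (killNullHomotopy p)

/-- The map from the cone of `p` to the cone of its extension. -/
def killCone : cone p ⟶ cone (killExt p) :=
  coneMap p (killExt p) (coneInl _) (𝟙 M) (by rw [killExt, coneInl_coneDesc, Category.comp_id])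

lemma coneInl_killCone : coneInl p ≫ killCone p = coneInl (killExt p) := by
  rw [killCone, coneInl_coneMap, Category.id_comp]

lemma cohomology_map_killCone (q : ℤ) : (cohomology A q).map (killCone p) = 0 := by
  refine (cohomology_map_eq_zero_iff _ _).2 fun z hz => ?_
  obtain ⟨q, rfl⟩ : ∃ r, q = r + 1 := ⟨q - 1, by lia⟩
  obtain ⟨h₁, h₂⟩ := cone_d_eq_zero.1 hz
  let e : ConeCocycle p := ⟨q + 1, (-z.2, z.1), by rw [map_neg, h₂, neg_zero], by
    rw [map_neg]; exact eq_neg_of_add_eq_zero_left h₁⟩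
  let g : (dsum (fun e : ConeCocycle p => free A (-(e.1 + 1)))).X (q + 1 + 1) :=
    Hom.f (dsumι _ e) (q + 1 + 1) (gen A (add_neg_cancel (q + 1 + 1)))
  have hs : (killNullHomotopy p).s rfl g = z.1 := killNullHomotopy_gen p e
  have hg : Hom.f (killMap p) _ g = -z.2 := killMap_gen p e
  have hdg : DGMod.d _ (rfl : q + 1 + 1 + 1 = _) g = 0 := by rw [← Hom.comm, d_gen, map_zero]
  refine cone_mem_coboundaries.2 ⟨0, ((0, g) : F.X (q + 1) × _), ?_, Prod.ext ?_ ?_⟩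
  · change M.d rfl 0 + (Hom.f p _ 0 + (killNullHomotopy p).s rfl g) = z.1
    rw [map_zero, map_zero, zero_add, zero_add, hs]
  · change -(F.d rfl 0 + Hom.f (killMap p) _ g) = z.2
    rw [hg, map_zero, zero_add, neg_neg]
  · change - -DGMod.d _ rfl g = 0
    rw [hdg, neg_zero, neg_zero]

end killing

instance (i : ℤ) : (shiftFun A i).Additive where
  map_add := rfl

end DGMod

namespace DerivedCat

open DGMod

variable {A : DGAlg k}

instance (i : ℤ) : (shift A i).Additive where
  map_add {X Y f g} := by
    obtain ⟨Y, rfl⟩ := Q_obj_surjective Y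
    obtain ⟨L, s, u, v, rfl, rfl⟩ := exists_rep₂ f g
    have h (w : L ⟶ Y) : (shift A i).map ((Q A).map w) = (shiftIso A i).hom.app L ≫
        (Q A).map ((shiftFun A i).map w) ≫ (shiftIso A i).inv.app Y := by
      rw [← cancel_mono ((shiftIso A i).hom.app Y), Category.assoc, Category.assoc,
        Iso.inv_hom_id_app]
      exact ((shiftIso A i).hom.naturality w).trans
        (congrArg (_ ≫ ·) (Category.comp_id _).symm)
    rw [← Preadditive.comp_add, ← Functor.map_add, Functor.map_comp, Functor.map_comp,
      Functor.map_comp, h, h, h, Functor.map_add, Functor.map_add]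
    simp only [Preadditive.add_comp, Preadditive.comp_add]

/-! ### The classes `⟨A⟩_n` -/

/-- The class whose only member is `A`. -/
abbrev selfProp (A : DGAlg k) : ObjectProperty (DerivedCat A) :=
  fun M => M = (Q A).obj (DGMod.self A)

attribute [local instance] preservesBinaryBiproducts_of_preservesBiproducts in
lemma addCl_induction {P : ObjectProperty (DerivedCat A)}
    (hiso : ∀ M N : DerivedCat A, (M ≅ N) → P M → P N) (hzero : ∀ M, IsZero M → P M)
    (hsum : ∀ (M N : DerivedCat A) (b : BinaryBicone M N), b.IsBilimit → P M → P N → P b.pt)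
    (hfree : ∀ i, P ((Q A).obj (free A i))) {M : DerivedCat A} (hM : addCl (selfProp A) M) :
    P M := by
  have hshift : ∀ i, P ((shift A i).obj M) := by
    induction hM with
    | of M h =>
      subst h
      exact fun i => hiso _ _ ((shiftIso A i).app _).symm (hfree i)
    | iso M N e _ ih => exact fun i => hiso _ _ ((shift A i).mapIso e) (ih i)
    | zero M h => exact fun i => hzero _ ((shift A i).map_isZero h)
    | sum M N b hb _ _ ih ih' =>
      exact fun i => hsum _ _ _ (isBinaryBilimitOfPreserves (shift A i) hb) (ih i) (ih' i)
    | shift M j _ ih =>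
      intro i
      obtain ⟨M, rfl⟩ := Q_obj_surjective M
      refine hiso _ _ ?_ (ih (i + j))
      exact (shiftIso A (i + j)).app M ≪≫ (Q A).mapIso (shiftShiftIso M j i _ rfl).symm ≪≫
        ((shiftIso A i).app _).symm ≪≫ (shift A i).mapIso ((shiftIso A j).app M).symm
  obtain ⟨M, rfl⟩ := Q_obj_surjective M
  exact hiso _ _ ((shiftIso A 0).app M ≪≫ (Q A).mapIso (shiftZeroIso M)) (hshift 0)

lemma addCl_free (i : ℤ) : addCl (selfProp A) ((Q A).obj (free A i)) :=
  addCl.iso _ _ ((shiftIso A i).app (self A)) (addCl.shift _ i (addCl.of _ rfl))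

lemma smd_of_retract {S : ObjectProperty (DerivedCat A)} {M G : DerivedCat A} (hG : smd S G)
    (i : M ⟶ G) (r : G ⟶ M) (hi : i ≫ r = 𝟙 M) : smd S M := by
  obtain ⟨N, b, ⟨hb⟩, rfl⟩ := exists_bicone_of_retract i r hi
  exact smd.summand M N b hb hG

lemma smd_induction {S P : ObjectProperty (DerivedCat A)} (hS : ∀ M, S M → P M)
    (hP : ∀ (M G : DerivedCat A) (i : M ⟶ G) (r : G ⟶ M), i ≫ r = 𝟙 M → P G → P M)
    {M : DerivedCat A} (hM : smd S M) : P M := by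
  induction hM with
  | of M h => exact hS M h
  | iso M N e _ ih => exact hP _ _ e.inv e.hom e.inv_hom_id ih
  | summand M N b _ _ ih => exact hP _ _ b.inl b.fst b.inl_fst ih

lemma thickSelf_induction {P : ℕ → ObjectProperty (DerivedCat A)}
    (hzero : ∀ M, IsZero M → P 0 M) (hone : ∀ M, addCl (selfProp A) M → P 1 M)
    (htriangle : ∀ (n : ℕ) (L M N : DerivedCat A) (f : L ⟶ M) (g : M ⟶ N)
      (h : N ⟶ (shift A 1).obj L), IsExactTriangle f g h → P (n + 1) L → P 1 N → P (n + 2) M)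
    (hretract : ∀ (n : ℕ) (M G : DerivedCat A) (i : M ⟶ G) (r : G ⟶ M), i ≫ r = 𝟙 M →
      P (n + 1) G → P (n + 1) M)
    {n : ℕ} {M : DerivedCat A} (hM : thickSelf A n M) : P n M := by
  have hone' (M : DerivedCat A) (hM : thickSelf A 1 M) : P 1 M :=
    smd_induction hone (hretract 0) hM
  induction n generalizing M with
  | zero => exact hzero M hM
  | succ n ih =>
    cases n with
    | zero => exact hone' M hM
    | succ n =>
      refine smd_induction ?_ (hretract (n + 1)) hM
      rintro M ⟨L, N, f, g, h, hL, hN, T⟩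
      exact htriangle n L M N f g h T (ih hL) (hone' N hN)

lemma thickSelf_of_retract {n : ℕ} {M G : DerivedCat A} (hG : thickSelf A n G) (i : M ⟶ G)
    (r : G ⟶ M) (hi : i ≫ r = 𝟙 M) : thickSelf A n M := by
  match n, hG with
  | 0, hG =>
    refine (IsZero.iff_id_eq_zero M).2 ?_
    rw [← hi, IsZero.eq_of_tgt hG i 0, zero_comp]
  | 1, hG => exact smd_of_retract hG i r hi
  | _ + 2, hG => exact smd_of_retract hG i r hi

lemma IsExactTriangle.thickSelf {n : ℕ} {L M N : DerivedCat A} {f : L ⟶ M} {g : M ⟶ N}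
    {h : N ⟶ (shift A 1).obj L} (T : IsExactTriangle f g h) (hL : thickSelf A n L)
    (hN : thickSelf A 1 N) : thickSelf A (n + 1) M := by
  match n, hL with
  | 0, hL =>
    obtain ⟨r, hr⟩ := T.exists_desc (𝟙 M) (IsZero.eq_of_src hL _ _)
    exact thickSelf_of_retract hN g r hr
  | _ + 1, hL => exact smd.of _ ⟨L, N, f, g, h, hL, hN, T⟩

lemma thickSelf_succ {n : ℕ} {M : DerivedCat A} (hM : thickSelf A n M) :
    thickSelf A (n + 1) M := by
  obtain ⟨N, g, h, T⟩ := exists_isExactTriangle (𝟙 M)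
  have : Epi g := T.epi_of_mono
  have hN : IsZero N := (IsZero.iff_id_eq_zero N).2 <| by
    rw [← cancel_epi g, comp_zero, Category.comp_id, ← T.comp_eq_zero, Category.id_comp]
  exact T.thickSelf hM (smd.of _ (addCl.zero _ hN))

lemma thickSelf_mono {m n : ℕ} (h : m ≤ n) {M : DerivedCat A} (hM : thickSelf A m M) :
    thickSelf A n M := by
  induction h with
  | refl => exact hM
  | step _ ih => exact thickSelf_succ ih

lemma isSmall_of_addCl {M : DerivedCat A} (hM : addCl (selfProp A) M) : IsSmall M :=
  addCl_induction (fun _ _ e h => h.of_retract e.inv e.hom e.inv_hom_id)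
    (fun _ => isSmall_of_isZero) (fun _ _ b hb h h' => h.bicone h' b hb) isSmall_free hM

lemma isSmall_of_thickSelf {n : ℕ} {M : DerivedCat A} (hM : thickSelf A n M) : IsSmall M :=
  thickSelf_induction (P := fun _ => IsSmall) (fun _ => isSmall_of_isZero)
    (fun _ => isSmall_of_addCl) (fun _ _ _ _ _ _ _ T => T.isSmall)
    (fun _ _ _ i r hi h => h.of_retract i r hi) hM

/-! ### The ghost lemma -/

lemma IsGhost.comp {L M N : DerivedCat A} (f : L ⟶ M) {g : M ⟶ N} (hg : IsGhost g) :
    IsGhost (f ≫ g) := fun q => by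
  rw [Functor.map_comp, hg q, comp_zero]

lemma isGhost_Q_map_iff {M N : DGMod A} (φ : M ⟶ N) :
    IsGhost ((Q A).map φ) ↔ ∀ q, (DGMod.cohomology A q).map φ = 0 := by
  refine forall_congr' fun q => ?_
  let e : Q A ⋙ cohomology A q ≅ DGMod.cohomology A q := Localization.fac _ _ _
  have h := e.hom.naturality φ
  constructor
  · intro h₀
    rw [← cancel_epi (e.hom.app M), ← h, Functor.comp_map, h₀, zero_comp, comp_zero]
  · intro h₀
    rw [← cancel_mono (e.hom.app N), zero_comp]
    refine Eq.trans h ?_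
    rw [h₀, comp_zero]

lemma isGhostComposite_one_iff {M N : DerivedCat A} {f : M ⟶ N} :
    IsGhostComposite 1 f ↔ IsGhost f := by
  constructor
  · intro h
    cases h with
    | comp f g _ hg => exact hg.comp f
  · intro h
    have := IsGhostComposite.comp _ f (IsGhostComposite.id M) h
    rwa [Category.id_comp] at this

-- The index is a successor because only identities are composites of `0` ghosts.
lemma IsGhostComposite.comp_left {n : ℕ} {L M N : DerivedCat A} (f : L ⟶ M) {g : M ⟶ N}
    (hg : IsGhostComposite (n + 1) g) : IsGhostComposite (n + 1) (f ≫ g) := by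
  induction n generalizing N with
  | zero => exact isGhostComposite_one_iff.2 ((isGhostComposite_one_iff.1 hg).comp f)
  | succ n ih =>
    cases hg with
    | comp g h hg hh =>
      rw [← Category.assoc]
      exact .comp _ _ (ih hg) hh

/-- The property that all composites of `n` ghosts out of `M` vanish. -/
def KillsGhosts (n : ℕ) (M : DerivedCat A) : Prop :=
  ∀ (N : DerivedCat A) (f : M ⟶ N), IsGhostComposite n f → f = 0

lemma KillsGhosts.of_retract {n : ℕ} {M G : DerivedCat A} (hG : KillsGhosts (n + 1) G)
    (i : M ⟶ G) (r : G ⟶ M) (hi : i ≫ r = 𝟙 M) : KillsGhosts (n + 1) M := fun N f hf => by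
  rw [← Category.id_comp f, ← hi, Category.assoc, hG _ _ (hf.comp_left r), comp_zero]

lemma KillsGhosts.bicone {n : ℕ} {M N : DerivedCat A} (hM : KillsGhosts (n + 1) M)
    (hN : KillsGhosts (n + 1) N) (b : BinaryBicone M N) (hb : b.IsBilimit) :
    KillsGhosts (n + 1) b.pt := fun P f hf => by
  rw [← Category.id_comp f, ← IsBilimit.binary_total hb, Preadditive.add_comp, Category.assoc,
    Category.assoc, hM _ _ (hf.comp_left b.inl), hN _ _ (hf.comp_left b.inr), comp_zero,
    comp_zero, add_zero]

lemma killsGhosts_one_free (i : ℤ) : KillsGhosts 1 ((Q A).obj (free A i)) := fun N f hf => by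
  obtain ⟨N, rfl⟩ := Q_obj_surjective N
  obtain ⟨g, rfl⟩ := exists_eq_Q_map_free f
  have h := (isGhost_Q_map_iff g).1 (isGhostComposite_one_iff.1 hf) (-i)
  exact Q_map_eq_zero (nonempty_nullHomotopy_free (neg_add_cancel i)
    ((cohomology_map_eq_zero_iff g _).1 h _ (d_gen _ _))).some

lemma IsExactTriangle.killsGhosts {n : ℕ} {L M N : DerivedCat A} {f : L ⟶ M} {g : M ⟶ N}
    {h : N ⟶ (shift A 1).obj L} (T : IsExactTriangle f g h) (hL : KillsGhosts (n + 1) L)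
    (hN : KillsGhosts 1 N) : KillsGhosts (n + 2) M := fun P x hx => by
  cases hx with
  | comp x y hx hy =>
    obtain ⟨z, rfl⟩ := T.exists_desc x (hL _ _ (hx.comp_left f))
    rw [Category.assoc, hN _ _ (isGhostComposite_one_iff.2 (hy.comp z)), comp_zero]

lemma killsGhosts_of_thickSelf {n : ℕ} {M : DerivedCat A} (hM : thickSelf A n M) :
    KillsGhosts n M :=
  thickSelf_induction (P := KillsGhosts) (fun _ hM _ _ _ => hM.eq_of_src _ _)
    (fun _ => addCl_induction (fun _ _ e h => h.of_retract e.inv e.hom e.inv_hom_id)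
      (fun _ hM _ _ _ => hM.eq_of_src _ _) (fun _ _ b hb h h' => h.bicone h' b hb)
      killsGhosts_one_free)
    (fun _ _ _ _ _ _ _ T => T.killsGhosts) (fun _ _ _ i r hi h => h.of_retract i r hi) hM

/-! ### The converse of the ghost lemma for compact objects -/

lemma isGhost_Q_map_killCone {F M : DGMod A} (p : F ⟶ M) : IsGhost ((Q A).map (killCone p)) :=
  (isGhost_Q_map_iff _).2 (cohomology_map_killCone p)

lemma exists_isSemifree_isGhostComposite (M : DGMod A) (n : ℕ) : ∃ (F : DGMod A) (p : F ⟶ M),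
    IsSemifree (n + 1) F ∧ IsGhostComposite (n + 1) ((Q A).map (coneInl p)) := by
  induction n with
  | zero =>
    refine ⟨_, killExt (0 : DGMod.zero A ⟶ M), .cone _ _ .zero, ?_⟩
    rw [← coneInl_killCone, Functor.map_comp]
    exact isGhostComposite_one_iff.2 ((isGhost_Q_map_killCone _).comp _)
  | succ n ih =>
    obtain ⟨F, p, hF, hp⟩ := ih
    refine ⟨_, killExt p, hF.cone _ (killMap p), ?_⟩
    rw [← coneInl_killCone, Functor.map_comp]
    exact .comp _ _ hp (isGhost_Q_map_killCone p)

lemma exists_addCl_bilimit {T T' : DerivedCat A} (hT : addCl (selfProp A) T)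
    (hT' : addCl (selfProp A) T') :
    ∃ b : BinaryBicone T T', addCl (selfProp A) b.pt := by
  obtain ⟨T, rfl⟩ := Q_obj_surjective T
  obtain ⟨T', rfl⟩ := Q_obj_surjective T'
  have := preservesBinaryBiproducts_of_preservesBiproducts (Q A)
  have hb : (prodBicone T T').IsBilimit := isBinaryBilimitOfTotal _ (by
    ext q x
    exact Prod.fst_add_snd x)
  exact ⟨_, addCl.sum _ _ _ (isBinaryBilimitOfPreserves (Q A) hb) hT hT'⟩

lemma exists_factor_of_mem_finiteMaps {J : Type u} {N : J → DGMod A}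
    (hN : ∀ j, addCl (selfProp A) ((Q A).obj (N j))) {X : DerivedCat A}
    {f : X ⟶ (Q A).obj (dsum N)} (hf : f ∈ finiteMaps N X) :
    ∃ (T : DerivedCat A) (u : X ⟶ T) (v : T ⟶ (Q A).obj (dsum N)),
      addCl (selfProp A) T ∧ u ≫ v = f := by
  induction hf using AddSubgroup.closure_induction with
  | mem f h =>
    obtain ⟨j, g, rfl⟩ := h
    exact ⟨_, g, (Q A).map (dsumι N j), hN j, rfl⟩
  | zero =>
    exact ⟨(Q A).obj (DGMod.zero A), 0, 0, addCl.zero _ ((Q A).map_isZero (isZero_zero A)),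
      comp_zero⟩
  | add f g _ _ hf hg =>
    obtain ⟨T, u, v, hT, rfl⟩ := hf
    obtain ⟨T', u', v', hT', rfl⟩ := hg
    obtain ⟨b, hb⟩ := exists_addCl_bilimit hT hT'
    refine ⟨b.pt, u ≫ b.inl + u' ≫ b.inr, b.fst ≫ v + b.snd ≫ v', hb, ?_⟩
    simp only [Preadditive.add_comp, Preadditive.comp_add, Category.assoc,
      BinaryBicone.inl_fst_assoc, BinaryBicone.inl_snd_assoc, BinaryBicone.inr_fst_assoc,
      BinaryBicone.inr_snd_assoc, zero_comp, comp_zero, add_zero, zero_add]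
  | neg f _ hf =>
    obtain ⟨T, u, v, hT, rfl⟩ := hf
    exact ⟨T, u, -v, hT, Preadditive.comp_neg u v⟩

lemma exists_factor_of_isSemifree {n : ℕ} {Y : DGMod A} (hY : IsSemifree n Y) {X : DerivedCat A}
    (hX : IsSmall X) (f : X ⟶ (Q A).obj Y) :
    ∃ (G : DerivedCat A) (a : X ⟶ G) (b : G ⟶ (Q A).obj Y), thickSelf A n G ∧ a ≫ b = f := by
  induction hY generalizing X with
  | zero => exact ⟨_, f, 𝟙 _, (Q A).map_isZero (isZero_zero A), Category.comp_id f⟩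
  | @cone n F J i ψ _ ih =>
    let e := (Q A).mapIso (shiftDsumIso (N := fun j => free A (i j)) 1)
    -- The composite of `f` with the projection to the suspended direct sum factors through some
    -- `T` in `addCl A`, so `f` lifts to `F` on the fibre `X'` of `X ⟶ T`.
    obtain ⟨T, u, v, hT, huv⟩ := exists_factor_of_mem_finiteMaps
      (fun j => addCl.iso _ _ ((shiftIso A 1).app _) (addCl.shift _ 1 (addCl_free (i j))))
      (hX _ _ ((f ≫ (Q A).map (coneSnd ψ)) ≫ e.hom))
    obtain ⟨X', i', j, h, T₁, hju⟩ := exists_fibre u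
    have hT' : addCl (selfProp A) ((shift A (-1)).obj T) := addCl.shift _ _ hT
    have hX' : IsSmall X' := T₁.isSmall (isSmall_of_addCl hT') hX
    obtain ⟨t, T₃⟩ := exists_isExactTriangle_of_shortExact (shortExact_cone ψ)
    have hjf : (j ≫ f) ≫ (Q A).map (coneSnd ψ) = 0 := by
      rw [← cancel_mono e.hom, Category.assoc, Category.assoc, ← Category.assoc f, ← huv,
        ← Category.assoc, hju, zero_comp, zero_comp]
    obtain ⟨y, hy⟩ := T₃.exists_lift (j ≫ f) hjf
    -- The lift factors through some `G` in `⟨A⟩_n`, and `f` through the pushout `P` of `X` and `G`.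
    obtain ⟨G, a, b, hG, rfl⟩ := ih hX' y
    obtain ⟨h', T₂⟩ := T₁.rotate
    obtain ⟨P, i₁, i₂, p, ⟨t', T₄⟩, hP⟩ := exists_pushout T₂ a
    obtain ⟨w, hw, -⟩ := hP _ f (b ≫ (Q A).map (coneInl ψ)) (by rw [← hy, Category.assoc])
    exact ⟨P, i₁, w, T₄.thickSelf hG (smd.of _ (addCl.shift _ _ hT')), hw⟩

lemma thickSelf_of_killsGhosts {n : ℕ} {M : DerivedCat A} (hM : IsSmall M)
    (h : KillsGhosts n M) : thickSelf A n M := by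
  obtain ⟨M, rfl⟩ := Q_obj_surjective M
  obtain _ | n := n
  · exact (IsZero.iff_id_eq_zero _).2 (h _ _ (.id _))
  obtain ⟨F, p, hF, hp⟩ := exists_isSemifree_isGhostComposite M n
  obtain ⟨s, hs⟩ := exists_cone_lift p (𝟙 _) ((Category.id_comp _).trans (h _ _ hp))
  obtain ⟨G, a, b, hG, rfl⟩ := exists_factor_of_isSemifree hF hM s
  exact thickSelf_of_retract hG a (b ≫ (Q A).map p) (by rw [← Category.assoc, hs])

lemma thickSelf_iff_killsGhosts {n : ℕ} {M : DerivedCat A} (hM : compact A M) :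
    thickSelf A n M ↔ KillsGhosts n M :=
  ⟨killsGhosts_of_thickSelf, thickSelf_of_killsGhosts (.of_compact hM)⟩

/-! ### Ghost length and level -/

lemma coe_toENNReal_natCast_ereal (n : ℕ) : (((n : ℕ∞) : ENNReal) : EReal) = n := by
  rw [ENat.toENNReal_coe, ← ENNReal.coe_natCast, EReal.coe_nnreal_eq_coe_real,
    NNReal.coe_natCast, EReal.coe_natCast]

lemma hasGhostLength_iff {n : ℕ} {M : DerivedCat A} (hM : compact A M) :
    HasGhostLength M n ↔ thickSelf A (n + 1) M ∧ ¬ thickSelf A n M := by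
  rw [thickSelf_iff_killsGhosts hM, thickSelf_iff_killsGhosts hM]
  simp only [HasGhostLength, KillsGhosts]
  push Not
  exact Iff.rfl

lemma level_le_iff {n : ℕ} {M : DerivedCat A} : level M ≤ n ↔ thickSelf A n M := by
  refine ⟨fun h => ?_, fun h => iInf₂_le n h⟩
  have h' : level M < ((n + 1 : ℕ) : ℕ∞) := lt_of_le_of_lt h (by exact_mod_cast n.lt_succ_self)
  simp only [level, iInf_lt_iff, Nat.cast_lt] at h'
  obtain ⟨m, hm, hmn⟩ := h'
  exact thickSelf_mono (Nat.le_of_lt_succ hmn) hm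

lemma level_eq_succ_iff {n : ℕ} {M : DerivedCat A} :
    level M = ((n + 1 : ℕ) : ℕ∞) ↔ thickSelf A (n + 1) M ∧ ¬ thickSelf A n M := by
  rw [← level_le_iff, ← level_le_iff, not_le, le_antisymm_iff, Nat.cast_add, Nat.cast_one,
    ENat.add_one_le_iff (ENat.natCast_ne_top n)]

lemma ghostLength_eq {M : DerivedCat A} (hM : compact A M) :
    ghostLength M = ((level M : ENNReal) : EReal) - 1 := by
  unfold ghostLength
  split_ifs with hzero
  · have h₀ : level M = 0 := nonpos_iff_eq_zero.1 (level_le_iff (n := 0).2 hzero)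
    simp [h₀]
  simp only [hasGhostLength_iff hM, ← level_eq_succ_iff]
  cases hlevel : level M with
  | top =>
    rw [ENat.toENNReal_top, EReal.coe_ennreal_top, ← EReal.coe_one, EReal.top_sub_coe]
    exact iInf₂_eq_top.2 fun n hn => (ENat.natCast_ne_top _ hn.symm).elim
  | coe m =>
    obtain _ | m := m
    · exact (hzero (level_le_iff (n := 0).1 hlevel.le)).elim
    · have hsub : ((((m + 1 : ℕ) : ℕ∞) : ENNReal) : EReal) - 1 = m := by
        rw [coe_toENNReal_natCast_ereal, ← EReal.coe_natCast, Nat.cast_add, Nat.cast_one,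
          EReal.coe_add, ← EReal.coe_one, EReal.add_sub_cancel_right, EReal.coe_natCast]
      rw [hsub]
      refine le_antisymm (iInf₂_le_of_le m rfl le_rfl) (le_iInf₂ fun n hn => ?_)
      rw [Nat.cast_inj, Nat.add_right_cancel_iff] at hn
      rw [hn]

end DerivedCat

namespace DGAlg

open DerivedCat

variable {A : DGAlg k}

lemma thickSelf_eq_compact_iff {n : ℕ} :
    thickSelf A n = compact A ↔ ∀ M, compact A M → thickSelf A n M :=
  ⟨fun h _ hM => h ▸ hM, fun h => funext fun _ =>
    propext ⟨fun hM => (isSmall_of_thickSelf hM).compact, h _⟩⟩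

lemma rouquierDim_le_iff {n : ℕ} :
    A.rouquierDim ≤ n ↔ ∀ M, compact A M → level M ≤ n := by
  simp only [level_le_iff]
  refine ⟨fun h M hM => ?_, fun h => iInf₂_le n (thickSelf_eq_compact_iff.2 h)⟩
  have h' : A.rouquierDim < ((n + 1 : ℕ) : ℕ∞) :=
    lt_of_le_of_lt h (by exact_mod_cast n.lt_succ_self)
  simp only [rouquierDim, iInf_lt_iff, Nat.cast_lt] at h'
  obtain ⟨m, hm, hmn⟩ := h'
  exact thickSelf_mono (Nat.le_of_lt_succ hmn) (thickSelf_eq_compact_iff.1 hm M hM)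

lemma rouquierDim_eq_iSup_level : A.rouquierDim = ⨆ M : {M // compact A M}, level M.1 :=
  eq_of_forall_ge_iff fun c => by
    cases c with
    | top => simp
    | coe n => simp [rouquierDim_le_iff]

instance : Nonempty {M // compact A M} :=
  ⟨⟨(Q A).obj (DGMod.zero A), (isSmall_of_isZero ((Q A).map_isZero (DGMod.isZero_zero A))).compact⟩⟩

lemma rouquierDim_eq_leftGhostDim_add_one :
    ((A.rouquierDim : ENNReal) : EReal) = A.leftGhostDim + 1 := by
  have hsub : GaloisConnection (fun x : EReal => x - 1) (fun y => y + 1) := fun _ _ =>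
    EReal.sub_le_iff_le_add (.inl (EReal.coe_ne_bot 1)) (.inl (EReal.coe_ne_top 1))
  have hcont : Continuous fun x : ℕ∞ => ((x : ENNReal) : EReal) :=
    continuous_coe_ennreal_ereal.comp ENat.continuous_toENNReal
  have hmono : Monotone fun x : ℕ∞ => ((x : ENNReal) : EReal) :=
    EReal.coe_ennreal_strictMono.monotone.comp ENat.toENNReal_mono
  have hcoe : ((A.rouquierDim : ENNReal) : EReal) =
      ⨆ M : {M // compact A M}, ((level M.1 : ENNReal) : EReal) := by
    rw [rouquierDim_eq_iSup_level]
    exact hmono.map_ciSup_of_continuousAt hcont.continuousAt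
  have hgh : A.leftGhostDim = ((A.rouquierDim : ENNReal) : EReal) - 1 := by
    rw [hcoe, leftGhostDim, iSup_subtype', hsub.l_iSup]
    exact iSup_congr fun M => ghostLength_eq M.2
  rw [hgh]
  exact (EReal.sub_add_cancel (b := 1)).symm

end DGAlg

end

theorem lemma5p6_general {k : Type u} [Field k] (A : DGAlg k) :
    (∀ M : DerivedCat A, DerivedCat.compact A M →
      DerivedCat.ghostLength M = ((DerivedCat.level M : ENNReal) : EReal) - 1) ∧
    ((A.rouquierDim : ENNReal) : EReal) = A.leftGhostDim + 1 :=
  ⟨fun _ hM => DerivedCat.ghostLength_eq hM, DGAlg.rouquierDim_eq_leftGhostDim_add_one⟩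

theorem lemma5p6 {k : Type u} [Field k] (A : DGAlg k) (hA : A.IsConnectedCochain) :
    (∀ M : DerivedCat A, DerivedCat.compact A M →
      DerivedCat.ghostLength M = ((DerivedCat.level M : ENNReal) : EReal) - 1) ∧
    ((A.rouquierDim : ENNReal) : EReal) = A.leftGhostDim + 1 :=
  lemma5p6_general A
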